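/- Let $a,b,\alpha>0$ and $\xi\in(0,1)$; all functions are complex-valued. Let $\mathcal H=[H^2(0,1)\cap H^1_0(0,1)]\times L^2(0,1)$ be equipped with the inner product $$(U_1,U_2)_{\mathcal H}=\int_0^1\big(a\,u_{1,xx}\,\overline{u_{2,xx}}+v_1\,\overline{v_2}\big)\,dx,\qquad U_i=(u_i,v_i).$$ Let $D(\mathcal A)$ be the set of all $U=(u,v)\in\mathcal H$ such that $u\in H^4(0,\xi)\cap H^4(\xi,1)\cap H^2(0,1)$, $v\in H^2(0,1)$, $u(0)=u(1)=v(0)=v(1)=0$, $u_{xx}(0)=u_{xx}(1)=0$, $u_{xx}(\xi^-)=u_{xx}(\xi^+)$ and $$u_{xxx}(\xi^+)-u_{xxx}(\xi^-)=-\frac{\alpha}{a}\,v(\xi),$$ and let $\mathcal A:D(\mathcal A)\to\mathcal H$ be the linear operator $$\mathcal A(u,v)=\big(v,\;-a\,u_{xxxx}-b\,v-\alpha\,v(\xi)\,\delta_\xi\big),$$ where the second component is understood as a distribution on $(0,1)$ (it belongs to $L^2(0,1)$ for $(u,v)\in D(\mathcal A)$, because of the jump condition at $\xi$). Then $\mathcal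 A$ is m-dissipative in $\mathcal H$, that is, $\operatorname{Re}(\mathcal AU,U)_{\mathcal H}\le 0$ for all $U\in D(\mathcal A)$, and $\mu I-\mathcal A:D(\mathcal A)\to\mathcal H$ is surjective for every $\mu>0$. More precisely, for every $U=(u,v)\in D(\mathcal A)$, $$\operatorname{Re}(\mathcal AU,U)_{\mathcal H}=-b\int_0^1|v(x)|^2\,dx-\alpha\,|v(\xi)|^2,$$ and $-\mathcal A:D(\mathcal A)\to\mathcal H$ is surjective. -/

import Mathlib

open MeasureTheory Set Filter
open scoped ContDiff

noncomputable section

namespace Beam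

/-- Real test functions on the open interval `(c, d)`. -/
def IsTest (c d : ℝ) (φ : ℝ → ℝ) : Prop :=
  ContDiff ℝ ∞ φ ∧ HasCompactSupport φ ∧ tsupport φ ⊆ Ioo c d

/-- `g` is a weak (distributional) derivative of order `k` of `f` on `(c, d)`. -/
def IsWeakDeriv (c d : ℝ) (k : ℕ) (f g : ℝ → ℂ) : Prop :=
  ∀ φ : ℝ → ℝ, IsTest c d φ →
    ∫ x in Ioo c d, iteratedDeriv k φ x • f x = (-1) ^ k * ∫ x in Ioo c d, φ x • g x

/-- The complex Lebesgue space `L²(c, d)`. -/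
abbrev L2 (c d : ℝ) : Type := Lp ℂ 2 (volume.restrict (Ioo c d))

theorem IsTest.test_deriv {c d : ℝ} {φ : ℝ → ℝ} (h : IsTest c d φ) : IsTest c d (deriv φ) :=
  ⟨(contDiff_infty_iff_deriv.1 h.1).2, h.2.1.deriv, (tsupport_deriv_subset).trans h.2.2⟩

theorem IsTest.test_iteratedDeriv {c d : ℝ} {φ : ℝ → ℝ} (h : IsTest c d φ) (k : ℕ) :
    IsTest c d (iteratedDeriv k φ) := by
  induction k with
  | zero => simpa using h
  | succ k ih => rw [iteratedDeriv_succ]; exact ih.test_deriv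

theorem IsTest.mono {c d c' d' : ℝ} {φ : ℝ → ℝ} (h : IsTest c d φ) (h1 : c' ≤ c) (h2 : d ≤ d') :
    IsTest c' d' φ := ⟨h.1, h.2.1, h.2.2.trans (Ioo_subset_Ioo h1 h2)⟩

theorem IsTest.eq_zero {c d : ℝ} {φ : ℝ → ℝ} (h : IsTest c d φ) {x : ℝ} (hx : x ∉ Ioo c d) :
    φ x = 0 := image_eq_zero_of_notMem_tsupport fun h' => hx (h.2.2 h')

theorem memLp_integrableOn {c d : ℝ} {f : ℝ → ℂ} (h : MemLp f 2 (volume.restrict (Ioo c d))) :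
    IntegrableOn f (Ioo c d) := h.integrable (by norm_num)

theorem L2.integrableOn {c d : ℝ} (f : L2 c d) : IntegrableOn f (Ioo c d) :=
  memLp_integrableOn (Lp.memLp f)

theorem IsTest.integrable_smul {c d : ℝ} {φ : ℝ → ℝ} (h : IsTest c d φ) {c' d' : ℝ} {f : ℝ → ℂ}
    (hf : IntegrableOn f (Ioo c' d')) :
    Integrable (fun x => φ x • f x) (volume.restrict (Ioo c' d')) := by
  obtain ⟨C, hC⟩ := h.2.1.exists_bound_of_continuous h.1.continuous
  exact Integrable.bdd_smul (C := C) hf h.1.continuous.aestronglyMeasurable (ae_of_all _ hC)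

/-- The fundamental lemma of the calculus of variations on an interval. -/
theorem ae_eq_of_test {c d : ℝ} {f g : ℝ → ℂ} (hf : IntegrableOn f (Ioo c d))
    (hg : IntegrableOn g (Ioo c d))
    (h : ∀ φ : ℝ → ℝ, IsTest c d φ →
      ∫ x in Ioo c d, φ x • f x = ∫ x in Ioo c d, φ x • g x) :
    f =ᵐ[volume.restrict (Ioo c d)] g := by
  have key := isOpen_Ioo.ae_eq_zero_of_integral_contDiff_smul_eq_zero (U := Ioo c d)
    (f := fun x => f x - g x) (μ := volume) (hf.sub hg).locallyIntegrableOn (by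
      intro φ h1 h2 h3
      have hφ : IsTest c d φ := ⟨h1, h2, h3⟩
      rw [← setIntegral_eq_integral_of_forall_compl_eq_zero (s := Ioo c d)
        (fun x hx => by rw [hφ.eq_zero hx, zero_smul])]
      simp only [smul_sub]
      rw [integral_sub (hφ.integrable_smul hf) (hφ.integrable_smul hg), h φ hφ, sub_self])
  rw [EventuallyEq, ae_restrict_iff' measurableSet_Ioo]
  filter_upwards [key] with x hx hx'
  exact sub_eq_zero.1 (hx hx')

theorem IsWeakDeriv.congr_left {c d : ℝ} {k : ℕ} {f f' g : ℝ → ℂ} (h : IsWeakDeriv c d k f g)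
    (hf : f =ᵐ[volume.restrict (Ioo c d)] f') : IsWeakDeriv c d k f' g := by
  intro φ hφ
  rw [← h φ hφ]
  exact integral_congr_ae (hf.mono fun x hx => by simp only [hx])

theorem IsWeakDeriv.congr_right {c d : ℝ} {k : ℕ} {f g g' : ℝ → ℂ} (h : IsWeakDeriv c d k f g)
    (hg : g =ᵐ[volume.restrict (Ioo c d)] g') : IsWeakDeriv c d k f g' := by
  intro φ hφ
  rw [h φ hφ]
  congr 1
  exact integral_congr_ae (hg.mono fun x hx => by simp only [hx])

theorem IsWeakDeriv.unique {c d : ℝ} {k : ℕ} {f g g' : ℝ → ℂ} (h : IsWeakDeriv c d k f g)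
    (h' : IsWeakDeriv c d k f g') (hg : IntegrableOn g (Ioo c d))
    (hg' : IntegrableOn g' (Ioo c d)) : g =ᵐ[volume.restrict (Ioo c d)] g' := by
  refine ae_eq_of_test hg hg' fun φ hφ => ?_
  have := (h φ hφ).symm.trans (h' φ hφ)
  exact mul_left_cancel₀ (pow_ne_zero _ (by norm_num)) this

theorem IsWeakDeriv.add {c d : ℝ} {k : ℕ} {f g f' g' : ℝ → ℂ} (h : IsWeakDeriv c d k f g)
    (h' : IsWeakDeriv c d k f' g') (hf : IntegrableOn f (Ioo c d))
    (hf' : IntegrableOn f' (Ioo c d)) (hg : IntegrableOn g (Ioo c d))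
    (hg' : IntegrableOn g' (Ioo c d)) :
    IsWeakDeriv c d k (fun x => f x + f' x) (fun x => g x + g' x) := by
  intro φ hφ
  have hk := hφ.test_iteratedDeriv k
  simp only [smul_add]
  rw [integral_add (hk.integrable_smul hf) (hk.integrable_smul hf'),
    integral_add (hφ.integrable_smul hg) (hφ.integrable_smul hg'), h φ hφ, h' φ hφ, mul_add]

theorem IsWeakDeriv.smul {c d : ℝ} {k : ℕ} {f g : ℝ → ℂ} (h : IsWeakDeriv c d k f g) (r : ℂ) :
    IsWeakDeriv c d k (fun x => r • f x) (fun x => r • g x) := by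
  intro φ hφ
  simp only [smul_comm _ r]
  rw [integral_smul, integral_smul, h φ hφ, smul_eq_mul, smul_eq_mul]
  ring

theorem IsWeakDeriv.mono {c d c' d' : ℝ} {k : ℕ} {f g : ℝ → ℂ} (h : IsWeakDeriv c d k f g)
    (h1 : c ≤ c') (h2 : d' ≤ d) : IsWeakDeriv c' d' k f g := by
  intro φ hφ
  have hk := hφ.test_iteratedDeriv k
  have e := h φ (hφ.mono h1 h2)
  rwa [setIntegral_eq_of_subset_of_forall_sdiff_eq_zero measurableSet_Ioo (Ioo_subset_Ioo h1 h2)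
      (fun x hx => by rw [hk.eq_zero hx.2, zero_smul]),
    setIntegral_eq_of_subset_of_forall_sdiff_eq_zero measurableSet_Ioo (Ioo_subset_Ioo h1 h2)
      (fun x hx => by rw [hφ.eq_zero hx.2, zero_smul])] at e

/-- If `g₁`, `g₂` are weak derivatives of orders `k`, `k + 1`, then `g₂` is that of `g₁`. -/
theorem IsWeakDeriv.step {c d : ℝ} {k : ℕ} {f g₁ g₂ : ℝ → ℂ} (h₁ : IsWeakDeriv c d k f g₁)
    (h₂ : IsWeakDeriv c d (k + 1) f g₂) : IsWeakDeriv c d 1 g₁ g₂ := by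
  intro φ hφ
  have e₁ := h₁ _ hφ.test_deriv
  rw [← iteratedDeriv_succ', h₂ φ hφ] at e₁
  rw [iteratedDeriv_one]
  have : ((-1 : ℂ) ^ k) ≠ 0 := pow_ne_zero _ (by norm_num)
  apply mul_left_cancel₀ this
  rw [← e₁]; ring

/-- Integration by parts of a smooth function against a primitive. -/
theorem ibp_real {c d : ℝ} {φ g : ℝ → ℝ} (hφ : ContDiff ℝ ∞ φ)
    (hg : IntervalIntegrable g volume c d) :
    ∫ x in c..d, deriv φ x * (∫ t in c..x, g t) =
      φ d * (∫ t in c..d, g t) - ∫ x in c..d, φ x * g x := by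
  have h1 : AbsolutelyContinuousOnInterval φ c d :=
    (hφ.of_le (by exact_mod_cast le_top)).contDiffOn.absolutelyContinuousOnInterval
  have h2 := hg.absolutelyContinuousOnInterval_intervalIntegral (c := c) (by simp)
  have e := h1.integral_mul_deriv_eq_deriv_mul h2
  have e2 : ∫ x in c..d, φ x * deriv (fun x => ∫ t in c..x, g t) x = ∫ x in c..d, φ x * g x := by
    apply intervalIntegral.integral_congr_ae
    filter_upwards [hg.ae_hasDerivAt_integral] with x hx hx'
    rw [(hx (uIoc_subset_uIcc hx') c (by simp)).deriv]
  rw [e2] at e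
  simp only [intervalIntegral.integral_same, mul_zero, sub_zero] at e
  linarith

theorem ibp {c d : ℝ} {φ : ℝ → ℝ} {g : ℝ → ℂ} (hφ : ContDiff ℝ ∞ φ)
    (hg : IntervalIntegrable g volume c d) :
    ∫ x in c..d, deriv φ x • (∫ t in c..x, g t) =
      φ d • (∫ t in c..d, g t) - ∫ x in c..d, φ x • g x := by
  have hsub : ∀ x ∈ uIcc c d, IntervalIntegrable g volume c x := fun x hx =>
    hg.mono_set (uIcc_subset_uIcc_left hx)
  have hprim : ContinuousOn (fun x => ∫ t in c..x, g t) (uIcc c d) :=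
    intervalIntegral.continuousOn_primitive_interval' hg (by simp)
  have hd : Continuous (deriv φ) := hφ.continuous_deriv (by simp)
  have hi1 : IntervalIntegrable (fun x => deriv φ x • (∫ t in c..x, g t)) volume c d :=
    (hd.continuousOn.smul hprim).intervalIntegrable
  have hi2 : IntervalIntegrable (fun x => φ x • g x) volume c d :=
    hg.continuousOn_smul hφ.continuous.continuousOn
  have main : ∀ L : ℂ →L[ℝ] ℝ, L (∫ x in c..d, deriv φ x • (∫ t in c..x, g t)) =
      L (φ d • (∫ t in c..d, g t) - ∫ x in c..d, φ x • g x) := by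
    intro L
    have hL : IntervalIntegrable (fun x => L (g x)) volume c d :=
      ⟨L.integrable_comp hg.1, L.integrable_comp hg.2⟩
    rw [map_sub, ← L.intervalIntegral_comp_comm hi1, ← L.intervalIntegral_comp_comm hi2,
      map_smul, ← L.intervalIntegral_comp_comm hg]
    simp only [map_smul, smul_eq_mul]
    rw [← ibp_real hφ hL]
    apply intervalIntegral.integral_congr
    intro x hx
    simp only
    rw [L.intervalIntegral_comp_comm (hsub x hx)]
  exact Complex.ext (main Complex.reCLM) (main Complex.imCLM)

theorem setIntegral_Ioo {c d : ℝ} (hcd : c ≤ d) (f : ℝ → ℂ) :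
    ∫ x in Ioo c d, f x = ∫ x in c..d, f x := by
  rw [intervalIntegral.integral_of_le hcd, integral_Ioc_eq_integral_Ioo]

theorem intervalIntegrable_of_Ioo {c d : ℝ} (hcd : c ≤ d) {f : ℝ → ℂ}
    (hf : IntegrableOn f (Ioo c d)) : IntervalIntegrable f volume c d :=
  (intervalIntegrable_iff_integrableOn_Ioo_of_le hcd).2 hf

theorem exists_test_integral_one {c d : ℝ} (hcd : c < d) :
    ∃ ψ : ℝ → ℝ, IsTest c d ψ ∧ ∫ x in c..d, ψ x = 1 := by
  let B : ContDiffBump ((c + d) / 2) :=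
    ⟨(d - c) / 8, (d - c) / 4, by linarith, by linarith⟩
  have hT : IsTest c d (B.normed volume) := by
    refine ⟨B.contDiff_normed, B.hasCompactSupport_normed, ?_⟩
    rw [B.tsupport_normed_eq, Real.closedBall_eq_Icc]
    intro x hx
    simp only [B, mem_Icc, mem_Ioo] at hx ⊢
    constructor <;> linarith [hx.1, hx.2]
  refine ⟨_, hT, ?_⟩
  rw [intervalIntegral.integral_of_le hcd.le, integral_Ioc_eq_integral_Ioo,
    setIntegral_eq_integral_of_forall_compl_eq_zero fun x hx => hT.eq_zero hx]
  exact B.integral_normed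

theorem IsTest.primitive {c d : ℝ} {φ : ℝ → ℝ} (hφ : IsTest c d φ)
    (h0 : ∫ x in c..d, φ x = 0) :
    ∃ Φ : ℝ → ℝ, IsTest c d Φ ∧ deriv Φ = φ := by
  have hder : ∀ x, HasDerivAt (fun x => ∫ t in c..x, φ t) (φ x) x := fun x =>
    intervalIntegral.integral_hasDerivAt_right (hφ.1.continuous.intervalIntegrable _ _)
      (hφ.1.continuous.stronglyMeasurableAtFilter _ _) hφ.1.continuous.continuousAt
  have hd : deriv (fun x => ∫ t in c..x, φ t) = φ := funext fun x => (hder x).deriv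
  refine ⟨fun x => ∫ t in c..x, φ t, ?_, hd⟩
  have hsm : ContDiff ℝ ∞ (fun x => ∫ t in c..x, φ t) :=
    contDiff_infty_iff_deriv.2 ⟨fun x => (hder x).differentiableAt, by rw [hd]; exact hφ.1⟩
  by_cases hne : (tsupport φ).Nonempty
  · have hK : IsCompact (tsupport φ) := hφ.2.1
    have h1 := hφ.2.2 (hK.sInf_mem hne)
    have h2 := hφ.2.2 (hK.sSup_mem hne)
    have hsub : tsupport (fun x => ∫ t in c..x, φ t) ⊆
        Icc (sInf (tsupport φ)) (sSup (tsupport φ)) := by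
      refine closure_minimal ?_ isClosed_Icc
      intro x hx
      by_contra hx'
      apply hx
      rw [mem_Icc, not_and_or, not_le, not_le] at hx'
      rcases hx' with hx' | hx'
      · have : EqOn φ (fun _ => 0) (uIcc c x) := by
          intro t ht
          apply image_eq_zero_of_notMem_tsupport
          intro ht'
          have := csInf_le hK.bddBelow ht'
          have h3 : t ≤ max c x := ht.2
          have := h1.1
          rcases le_max_iff.1 h3 with h | h <;> linarith
        simp only
        rw [intervalIntegral.integral_congr this]
        simp
      · have : EqOn φ (fun _ => 0) (uIcc d x) := by
          intro t ht
          apply image_eq_zero_of_notMem_tsupport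
          intro ht'
          have := le_csSup hK.bddAbove ht'
          have h3 : min d x ≤ t := ht.1
          have := h2.2
          rcases min_le_iff.1 h3 with h | h <;> linarith
        simp only
        rw [← intervalIntegral.integral_add_adjacent_intervals
          (hφ.1.continuous.intervalIntegrable c d) (hφ.1.continuous.intervalIntegrable d x),
          h0, intervalIntegral.integral_congr this]
        simp
    exact ⟨hsm, isCompact_Icc.of_isClosed_subset (isClosed_tsupport _) hsub,
      hsub.trans fun x hx => ⟨h1.1.trans_le hx.1, hx.2.trans_lt h2.2⟩⟩
  · have hz : φ = 0 := by
      rw [not_nonempty_iff_eq_empty, tsupport_eq_empty_iff] at hne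
      exact hne
    have : (fun x => ∫ t in c..x, φ t) = fun _ => (0 : ℝ) := by
      funext x; simp [hz]
    rw [this]
    refine ⟨contDiff_const, HasCompactSupport.zero, ?_⟩
    have : tsupport (fun _ : ℝ => (0 : ℝ)) = ∅ := tsupport_eq_empty_iff.2 rfl
    rw [this]; exact empty_subset _

/-- Du Bois-Reymond: a function with zero weak derivative is constant. -/
theorem ae_const_of_weakDeriv_zero {c d : ℝ} (hcd : c < d) {h : ℝ → ℂ}
    (hh : IntegrableOn h (Ioo c d))
    (h0 : ∀ φ : ℝ → ℝ, IsTest c d φ → ∫ x in Ioo c d, deriv φ x • h x = 0) :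
    ∃ C : ℂ, h =ᵐ[volume.restrict (Ioo c d)] fun _ => C := by
  obtain ⟨ψ, hψ, hψ1⟩ := exists_test_integral_one hcd
  refine ⟨∫ x in Ioo c d, ψ x • h x, ae_eq_of_test hh (by simp) fun φ hφ => ?_⟩
  set m := ∫ x in c..d, φ x with hm
  have hT : IsTest c d (fun x => φ x - m * ψ x) := by
    have e : (fun x => φ x - m * ψ x) = φ - fun x => m * ψ x := rfl
    refine ⟨hφ.1.sub (contDiff_const.mul hψ.1), ?_, ?_⟩
    · rw [e, sub_eq_add_neg]
      exact hφ.2.1.add (hψ.2.1.mul_left.neg)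
    · rw [e]
      refine (tsupport_sub _ _).trans (union_subset hφ.2.2 (Subset.trans ?_ hψ.2.2))
      exact tsupport_mul_subset_right
  obtain ⟨Φ, hΦ, hΦ'⟩ := hT.primitive (by
    rw [intervalIntegral.integral_sub (hφ.1.continuous.intervalIntegrable _ _)
      ((hψ.1.continuous.const_mul m).intervalIntegrable _ _),
      intervalIntegral.integral_const_mul, hψ1]
    simp [hm])
  have key := h0 Φ hΦ
  rw [hΦ'] at key
  have e : ∀ x, (φ x - m * ψ x) • h x = φ x • h x - m • (ψ x • h x) := fun x => by
    rw [sub_smul, mul_smul]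
  simp only [e] at key
  have i2 : Integrable (fun x => m • (ψ x • h x)) (volume.restrict (Ioo c d)) :=
    (hψ.integrable_smul hh).smul m
  rw [integral_sub (hφ.integrable_smul hh) i2, integral_smul, sub_eq_zero] at key
  rw [key, integral_smul_const, hm, intervalIntegral.integral_of_le hcd.le,
    integral_Ioc_eq_integral_Ioo]

/-- A function with an integrable weak derivative is a.e. a primitive of it. -/
theorem IsWeakDeriv.exists_primitive {c d : ℝ} (hcd : c < d) {f g : ℝ → ℂ}
    (h : IsWeakDeriv c d 1 f g) (hf : IntegrableOn f (Ioo c d)) (hg : IntegrableOn g (Ioo c d)) :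
    ∃ C : ℂ, f =ᵐ[volume.restrict (Ioo c d)] fun x => C + ∫ t in c..x, g t := by
  have hgi := intervalIntegrable_of_Ioo hcd.le hg
  have hprim : ContinuousOn (fun x => ∫ t in c..x, g t) (uIcc c d) :=
    intervalIntegral.continuousOn_primitive_interval' hgi (by simp)
  have hG : IntegrableOn (fun x => ∫ t in c..x, g t) (Ioo c d) :=
    (intervalIntegrable_iff_integrableOn_Ioo_of_le hcd.le).1 hprim.intervalIntegrable
  obtain ⟨C, hC⟩ := ae_const_of_weakDeriv_zero hcd (hf.sub hG) (by
    intro φ hφ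
    have e := h φ hφ
    rw [iteratedDeriv_one, pow_one, neg_one_mul] at e
    simp only [Pi.sub_apply, smul_sub]
    rw [integral_sub (hφ.test_deriv.integrable_smul hf) (hφ.test_deriv.integrable_smul hG), e,
      setIntegral_Ioo hcd.le, setIntegral_Ioo hcd.le, ibp hφ.1 hgi,
      hφ.eq_zero (x := d) (by simp), zero_smul]
    ring)
  refine ⟨C, hC.mono fun x hx => ?_⟩
  simp only [Pi.sub_apply] at hx
  rw [← hx]; ring

/-- `f` belongs to the Sobolev space `H^m(c, d)`: `f` and its weak derivatives of orders up to `m`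
are in `L²(c, d)`. -/
def MemH (m : ℕ) (c d : ℝ) (f : ℝ → ℂ) : Prop :=
  MemLp f 2 (volume.restrict (Ioo c d)) ∧ ∀ k ≤ m, ∃ g : L2 c d, IsWeakDeriv c d k f g

open Classical in
/-- The weak derivative of order `k` of `f` on `(c, d)`, if it exists in `L²(c, d)`. -/
def weakDeriv (c d : ℝ) (k : ℕ) (f : ℝ → ℂ) : L2 c d :=
  if h : ∃ g : L2 c d, IsWeakDeriv c d k f g then h.choose else 0

/-- `f` has a representative that is continuous on `[c, d]` and takes the value `z` at `x`. -/
def HasValue (c d : ℝ) (f : ℝ → ℂ) (x : ℝ) (z : ℂ) : Prop :=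
  ∃ g : ℝ → ℂ, ContinuousOn g (Icc c d) ∧ f =ᵐ[volume.restrict (Ioo c d)] g ∧ g x = z

open Classical in
/-- The value at `x ∈ [c, d]` of the continuous representative on `[c, d]` of `f`. At `x = c` and
`x = d` it is the one-sided limit `f(c⁺)`, resp. `f(d⁻)`. -/
def value (c d : ℝ) (f : ℝ → ℂ) (x : ℝ) : ℂ :=
  if h : ∃ z, HasValue c d f x z then h.choose else 0

theorem IsWeakDeriv.weakDeriv_eq {c d : ℝ} {k : ℕ} {f : ℝ → ℂ} {g : L2 c d}
    (h : IsWeakDeriv c d k f g) : weakDeriv c d k f = g := by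
  have hex : ∃ g : L2 c d, IsWeakDeriv c d k f g := ⟨g, h⟩
  rw [weakDeriv, dif_pos hex]
  exact Lp.ext (hex.choose_spec.unique h (L2.integrableOn _) (L2.integrableOn _))

theorem MemH.isWeakDeriv {m k : ℕ} {c d : ℝ} {f : ℝ → ℂ} (h : MemH m c d f) (hk : k ≤ m) :
    IsWeakDeriv c d k f (weakDeriv c d k f) := by
  obtain ⟨g, hg⟩ := h.2 k hk
  rwa [hg.weakDeriv_eq]

theorem MemH.congr {m : ℕ} {c d : ℝ} {f f' : ℝ → ℂ} (h : MemH m c d f)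
    (hf : f =ᵐ[volume.restrict (Ioo c d)] f') : MemH m c d f' :=
  ⟨(memLp_congr_ae hf).1 h.1, fun k hk => (h.2 k hk).imp fun _ hg => hg.congr_left hf⟩

theorem weakDeriv_congr {c d : ℝ} {k : ℕ} {f f' : ℝ → ℂ}
    (hf : f =ᵐ[volume.restrict (Ioo c d)] f') : weakDeriv c d k f = weakDeriv c d k f' := by
  by_cases h : ∃ g : L2 c d, IsWeakDeriv c d k f g
  · obtain ⟨g, hg⟩ := h
    rw [hg.weakDeriv_eq, (hg.congr_left hf).weakDeriv_eq]
  · have h' : ¬ ∃ g : L2 c d, IsWeakDeriv c d k f' g := fun ⟨g, hg⟩ =>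
      h ⟨g, hg.congr_left hf.symm⟩
    rw [weakDeriv, weakDeriv, dif_neg h, dif_neg h']

theorem MemH.isWeakDeriv_add {m k : ℕ} {c d : ℝ} {f f' : ℝ → ℂ} (h : MemH m c d f)
    (h' : MemH m c d f') (hk : k ≤ m) :
    IsWeakDeriv c d k (fun x => f x + f' x) (weakDeriv c d k f + weakDeriv c d k f' : L2 c d) :=
  ((h.isWeakDeriv hk).add (h'.isWeakDeriv hk) (memLp_integrableOn h.1) (memLp_integrableOn h'.1)
    (L2.integrableOn _) (L2.integrableOn _)).congr_right (Lp.coeFn_add _ _).symm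

theorem MemH.isWeakDeriv_smul {m k : ℕ} {c d : ℝ} {f : ℝ → ℂ} (h : MemH m c d f) (r : ℂ)
    (hk : k ≤ m) : IsWeakDeriv c d k (fun x => r • f x) (r • weakDeriv c d k f : L2 c d) :=
  ((h.isWeakDeriv hk).smul r).congr_right
    (Lp.coeFn_smul r (weakDeriv c d k f)).symm

theorem MemH.add {m : ℕ} {c d : ℝ} {f f' : ℝ → ℂ} (h : MemH m c d f) (h' : MemH m c d f') :
    MemH m c d (fun x => f x + f' x) :=
  ⟨h.1.add h'.1, fun _ hk => ⟨_, h.isWeakDeriv_add h' hk⟩⟩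

theorem MemH.smul {m : ℕ} {c d : ℝ} {f : ℝ → ℂ} (h : MemH m c d f) (r : ℂ) :
    MemH m c d (fun x => r • f x) :=
  ⟨h.1.const_smul r, fun _ hk => ⟨_, h.isWeakDeriv_smul r hk⟩⟩

theorem MemH.zero {m : ℕ} {c d : ℝ} : MemH m c d (fun _ => 0) :=
  ⟨MemLp.zero, fun k _ => ⟨0, fun φ _ => by
    have : ∫ x in Ioo c d, φ x • (0 : L2 c d) x = ∫ x in Ioo c d, (0 : ℂ) :=
      integral_congr_ae ((Lp.coeFn_zero ℂ 2 _).mono fun x hx => by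
        simp only [hx, Pi.zero_apply, smul_zero])
    rw [this]; simp⟩⟩

theorem HasValue.unique {c d x : ℝ} (hcd : c < d) (hx : x ∈ Icc c d) {f : ℝ → ℂ} {z z' : ℂ}
    (h : HasValue c d f x z) (h' : HasValue c d f x z') : z = z' := by
  obtain ⟨g, hg, hfg, rfl⟩ := h
  obtain ⟨g', hg', hfg', rfl⟩ := h'
  refine Measure.eqOn_of_ae_eq (μ := volume) (X := ℝ) ?_ hg hg' ?_ hx
  · rw [← restrict_Ioo_eq_restrict_Icc]
    exact hfg.symm.trans hfg'
  · rw [interior_Icc, closure_Ioo hcd.ne]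

theorem HasValue.value_eq {c d x : ℝ} (hcd : c < d) (hx : x ∈ Icc c d) {f : ℝ → ℂ} {z : ℂ}
    (h : HasValue c d f x z) : value c d f x = z := by
  have hex : ∃ z, HasValue c d f x z := ⟨z, h⟩
  rw [value, dif_pos hex]
  exact hex.choose_spec.unique hcd hx h

theorem HasValue.add {c d x : ℝ} {f f' : ℝ → ℂ} {z z' : ℂ}
    (h : HasValue c d f x z) (h' : HasValue c d f' x z') :
    HasValue c d (fun x => f x + f' x) x (z + z') := by
  obtain ⟨g, hg, hfg, rfl⟩ := h
  obtain ⟨g', hg', hfg', rfl⟩ := h'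
  exact ⟨_, hg.add hg', hfg.add hfg', rfl⟩

theorem HasValue.smul {c d x : ℝ} {f : ℝ → ℂ} {z : ℂ} (h : HasValue c d f x z) (r : ℂ) :
    HasValue c d (fun x => r • f x) x (r • z) := by
  obtain ⟨g, hg, hfg, rfl⟩ := h
  exact ⟨_, hg.const_smul r, hfg.const_smul r, rfl⟩

theorem HasValue.zero {c d x : ℝ} : HasValue c d (fun _ => 0) x 0 :=
  ⟨_, continuousOn_const, Filter.EventuallyEq.rfl, rfl⟩

theorem HasValue.congr {c d x : ℝ} {f f' : ℝ → ℂ} {z : ℂ} (h : HasValue c d f x z)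
    (hf : f =ᵐ[volume.restrict (Ioo c d)] f') : HasValue c d f' x z := by
  obtain ⟨g, hg, hfg, rfl⟩ := h
  exact ⟨g, hg, hf.symm.trans hfg, rfl⟩

/-- Functions in `H¹(c, d)` have a continuous representative on `[c, d]`. -/
theorem hasValue_of_isWeakDeriv {c d : ℝ} (hcd : c < d) {f g : ℝ → ℂ} (h : IsWeakDeriv c d 1 f g)
    (hf : IntegrableOn f (Ioo c d)) (hg : IntegrableOn g (Ioo c d)) {x : ℝ} (hx : x ∈ Icc c d) :
    HasValue c d f x (value c d f x) := by
  obtain ⟨C, hC⟩ := h.exists_primitive hcd hf hg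
  have hcont : ContinuousOn (fun x => C + ∫ t in c..x, g t) (Icc c d) := by
    rw [← uIcc_of_le hcd.le]
    exact continuousOn_const.add (intervalIntegral.continuousOn_primitive_interval'
      (intervalIntegrable_of_Ioo hcd.le hg) (by simp))
  have hv : HasValue c d f x (C + ∫ t in c..x, g t) := ⟨_, hcont, hC, rfl⟩
  rwa [hv.value_eq hcd hx]

theorem MemH.hasValue {m : ℕ} {c d : ℝ} (hcd : c < d) {f : ℝ → ℂ} (h : MemH m c d f)
    (hm : 1 ≤ m) {x : ℝ} (hx : x ∈ Icc c d) : HasValue c d f x (value c d f x) :=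
  hasValue_of_isWeakDeriv hcd (h.isWeakDeriv hm) (memLp_integrableOn h.1) (L2.integrableOn _) hx

theorem MemH.hasValue_weakDeriv {m k : ℕ} {c d : ℝ} (hcd : c < d) {f : ℝ → ℂ} (h : MemH m c d f)
    (hk : k + 1 ≤ m) {x : ℝ} (hx : x ∈ Icc c d) :
    HasValue c d (weakDeriv c d k f) x (value c d (weakDeriv c d k f) x) :=
  hasValue_of_isWeakDeriv hcd ((h.isWeakDeriv (k.le_succ.trans hk)).step (h.isWeakDeriv hk))
    (L2.integrableOn _) (L2.integrableOn _) hx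

theorem MemH.value_add {m : ℕ} {c d : ℝ} (hcd : c < d) {f f' : ℝ → ℂ} (h : MemH m c d f)
    (h' : MemH m c d f') (hm : 1 ≤ m) {x : ℝ} (hx : x ∈ Icc c d) :
    value c d (fun x => f x + f' x) x = value c d f x + value c d f' x :=
  ((h.hasValue hcd hm hx).add (h'.hasValue hcd hm hx)).value_eq hcd hx

theorem MemH.value_smul {m : ℕ} {c d : ℝ} (hcd : c < d) {f : ℝ → ℂ} (h : MemH m c d f) (r : ℂ)
    (hm : 1 ≤ m) {x : ℝ} (hx : x ∈ Icc c d) :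
    value c d (fun x => r • f x) x = r • value c d f x :=
  ((h.hasValue hcd hm hx).smul r).value_eq hcd hx

theorem MemH.value_weakDeriv_add {m k : ℕ} {c d : ℝ} (hcd : c < d) {f f' : ℝ → ℂ}
    (h : MemH m c d f) (h' : MemH m c d f') (hk : k + 1 ≤ m) {x : ℝ} (hx : x ∈ Icc c d) :
    value c d (weakDeriv c d k (fun x => f x + f' x)) x =
      value c d (weakDeriv c d k f) x + value c d (weakDeriv c d k f') x := by
  rw [(h.isWeakDeriv_add h' (k.le_succ.trans hk)).weakDeriv_eq]
  exact (((h.hasValue_weakDeriv hcd hk hx).add (h'.hasValue_weakDeriv hcd hk hx)).congr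
    (Lp.coeFn_add _ _).symm).value_eq hcd hx

theorem MemH.value_weakDeriv_smul {m k : ℕ} {c d : ℝ} (hcd : c < d) {f : ℝ → ℂ}
    (h : MemH m c d f) (r : ℂ) (hk : k + 1 ≤ m) {x : ℝ} (hx : x ∈ Icc c d) :
    value c d (weakDeriv c d k (fun x => r • f x)) x = r • value c d (weakDeriv c d k f) x := by
  rw [(h.isWeakDeriv_smul r (k.le_succ.trans hk)).weakDeriv_eq]
  exact (((h.hasValue_weakDeriv hcd hk hx).smul r).congr
    (Lp.coeFn_smul r (weakDeriv c d k f)).symm).value_eq hcd hx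

theorem value_congr {c d x : ℝ} {f f' : ℝ → ℂ} (hf : f =ᵐ[volume.restrict (Ioo c d)] f') :
    value c d f x = value c d f' x := by
  have : HasValue c d f x = HasValue c d f' x := by
    funext z
    exact propext ⟨fun h => h.congr hf, fun h => h.congr hf.symm⟩
  classical
  exact congrArg (fun P : ℂ → Prop => if h : ∃ z, P z then h.choose else 0) this

theorem value_zero {c d x : ℝ} (hcd : c < d) (hx : x ∈ Icc c d) :
    value c d (fun _ => 0) x = 0 := HasValue.zero.value_eq hcd hx

theorem value_weakDeriv_zero {k : ℕ} {c d x : ℝ} (hcd : c < d) (hx : x ∈ Icc c d) :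
    value c d (weakDeriv c d k (fun _ => 0)) x = 0 := by
  have := (MemH.zero (m := k + 1) (c := c) (d := d)).value_weakDeriv_smul hcd 0 le_rfl hx
  simpa using this

/-- Integration by parts of a smooth function against an `H¹(c, d)` function. -/
theorem IsWeakDeriv.integral_deriv_smul {c d : ℝ} (hcd : c < d) {f g : ℝ → ℂ}
    (h : IsWeakDeriv c d 1 f g) (hf : IntegrableOn f (Ioo c d)) (hg : IntegrableOn g (Ioo c d))
    {φ : ℝ → ℝ} (hφ : ContDiff ℝ ∞ φ) :
    ∫ x in Ioo c d, deriv φ x • f x =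
      φ d • value c d f d - φ c • value c d f c - ∫ x in Ioo c d, φ x • g x := by
  obtain ⟨C, hC⟩ := h.exists_primitive hcd hf hg
  have hgi := intervalIntegrable_of_Ioo hcd.le hg
  have hprim : ContinuousOn (fun x => ∫ t in c..x, g t) (uIcc c d) :=
    intervalIntegral.continuousOn_primitive_interval' hgi (by simp)
  have hcont : ContinuousOn (fun x => C + ∫ t in c..x, g t) (Icc c d) := by
    rw [← uIcc_of_le hcd.le]
    exact continuousOn_const.add hprim
  have hv : ∀ x ∈ Icc c d, value c d f x = C + ∫ t in c..x, g t := fun x hx =>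
    HasValue.value_eq hcd hx ⟨_, hcont, hC, rfl⟩
  have hd : Continuous (deriv φ) := hφ.continuous_deriv (by simp)
  rw [hv d (by simp [hcd.le]), hv c (by simp [hcd.le]), intervalIntegral.integral_same,
    integral_congr_ae (hC.mono fun x hx => by simp only [hx] :
      (fun x => deriv φ x • f x) =ᵐ[volume.restrict (Ioo c d)]
        fun x => deriv φ x • (C + ∫ t in c..x, g t)),
    setIntegral_Ioo hcd.le, setIntegral_Ioo hcd.le]
  simp only [smul_add]
  have i1 : IntervalIntegrable (fun x => deriv φ x • C) volume c d :=
    (hd.smul continuous_const).intervalIntegrable _ _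
  have i2 : IntervalIntegrable (fun x => deriv φ x • ∫ t in c..x, g t) volume c d :=
    (hd.continuousOn.smul hprim).intervalIntegrable
  rw [intervalIntegral.integral_add i1 i2, ibp hφ hgi,
    intervalIntegral.integral_smul_const, intervalIntegral.integral_deriv_eq_sub
      (fun x _ => (hφ.differentiable (by simp)) x) (hd.intervalIntegrable _ _)]
  simp only [sub_smul, smul_zero]
  ring

theorem MemH.integral_deriv_deriv_smul {c d : ℝ} (hcd : c < d) {f : ℝ → ℂ} (h : MemH 4 c d f)
    {φ : ℝ → ℝ} (hφ : ContDiff ℝ ∞ φ) :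
    ∫ x in Ioo c d, deriv (deriv φ) x • weakDeriv c d 2 f x =
      deriv φ d • value c d (weakDeriv c d 2 f) d - deriv φ c • value c d (weakDeriv c d 2 f) c
      - (φ d • value c d (weakDeriv c d 3 f) d - φ c • value c d (weakDeriv c d 3 f) c)
      + ∫ x in Ioo c d, φ x • weakDeriv c d 4 f x := by
  have h2 := h.isWeakDeriv (k := 2) (by norm_num)
  have h3 := h.isWeakDeriv (k := 3) (by norm_num)
  have h4 := h.isWeakDeriv (k := 4) (by norm_num)
  rw [(h2.step h3).integral_deriv_smul hcd (L2.integrableOn _) (L2.integrableOn _)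
      (contDiff_infty_iff_deriv.1 hφ).2,
    (h3.step h4).integral_deriv_smul hcd (L2.integrableOn _) (L2.integrableOn _) hφ]
  ring

/-- The parameters of the beam equation
`u_tt + a u_xxxx + b u_t + α u_t(ξ, t) δ_ξ = 0` on `(0, 1)`. -/
structure Params where
  a : ℝ
  b : ℝ
  α : ℝ
  ξ : ℝ
  a_pos : 0 < a
  b_pos : 0 < b
  α_pos : 0 < α
  ξ_mem : ξ ∈ Ioo (0 : ℝ) 1

/-- `H²(0, 1) ∩ H¹₀(0, 1)` as a subspace of `L²(0, 1)`; in dimension one `H¹₀(0, 1)` consists of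
the functions in `H¹(0, 1)` that vanish at `0` and `1`. -/
def H2H10 : Submodule ℂ (L2 0 1) where
  carrier := {u | MemH 2 0 1 u ∧ value 0 1 u 0 = 0 ∧ value 0 1 u 1 = 0}
  add_mem' {u w} hu hw := by
    have e : (fun x => u x + w x) =ᵐ[volume.restrict (Ioo 0 1)] (u + w : L2 0 1) :=
      (Lp.coeFn_add u w).symm
    refine ⟨(hu.1.add hw.1).congr e, ?_, ?_⟩
    · rw [← value_congr e, hu.1.value_add zero_lt_one hw.1 (by norm_num) (by simp), hu.2.1, hw.2.1,
        add_zero]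
    · rw [← value_congr e, hu.1.value_add zero_lt_one hw.1 (by norm_num) (by simp), hu.2.2, hw.2.2,
        add_zero]
  zero_mem' := by
    have e : (fun _ => 0) =ᵐ[volume.restrict (Ioo 0 1)] (0 : L2 0 1) :=
      (Lp.coeFn_zero ℂ 2 _).symm
    refine ⟨MemH.zero.congr e, ?_, ?_⟩
    · rw [← value_congr e, value_zero zero_lt_one (by simp)]
    · rw [← value_congr e, value_zero zero_lt_one (by simp)]
  smul_mem' r u hu := by
    have e : (fun x => r • u x) =ᵐ[volume.restrict (Ioo 0 1)] (r • u : L2 0 1) :=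
      (Lp.coeFn_smul r u).symm
    refine ⟨(hu.1.smul r).congr e, ?_, ?_⟩
    · rw [← value_congr e, hu.1.value_smul zero_lt_one r (by norm_num) (by simp), hu.2.1,
        smul_zero]
    · rw [← value_congr e, hu.1.value_smul zero_lt_one r (by norm_num) (by simp), hu.2.2,
        smul_zero]

namespace Params

/-- The space `H²(0, 1) ∩ H¹₀(0, 1)`, to be equipped with the inner product `a ∫ u_xx w_xx`. -/
def Disp (_p : Params) : Type := H2H10

instance (p : Params) : AddCommGroup p.Disp := inferInstanceAs (AddCommGroup H2H10)

instance (p : Params) : Module ℂ p.Disp := inferInstanceAs (Module ℂ H2H10)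

variable {p : Params}

/-- The underlying element of `L²(0, 1)`. -/
def Disp.toL2 : p.Disp →ₗ[ℂ] L2 0 1 := H2H10.subtype

theorem Disp.memH (u : p.Disp) : MemH 2 0 1 u.toL2 := u.2.1

theorem Disp.value_zero (u : p.Disp) : value 0 1 u.toL2 0 = 0 := u.2.2.1

theorem Disp.value_one (u : p.Disp) : value 0 1 u.toL2 1 = 0 := u.2.2.2

theorem Disp.toL2_injective : Function.Injective (Disp.toL2 (p := p)) :=
  Subtype.val_injective

/-- The second weak derivative `u ↦ u_xx`. -/
def Disp.dxx : p.Disp →ₗ[ℂ] L2 0 1 where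
  toFun u := weakDeriv 0 1 2 u.toL2
  map_add' u w := by
    rw [map_add, weakDeriv_congr (Lp.coeFn_add u.toL2 w.toL2)]
    exact (u.memH.isWeakDeriv_add w.memH le_rfl).weakDeriv_eq
  map_smul' r u := by
    rw [map_smul, weakDeriv_congr (Lp.coeFn_smul r u.toL2)]
    exact (u.memH.isWeakDeriv_smul r le_rfl).weakDeriv_eq

theorem Disp.eq_zero_of_dxx (u : p.Disp) (h : u.dxx = 0) : u = 0 := by
  have h01 : (0 : ℝ) < 1 := zero_lt_one
  set f : ℝ → ℂ := (u.toL2 : ℝ → ℂ)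
  set g : L2 0 1 := weakDeriv 0 1 1 f
  have h1 : IsWeakDeriv 0 1 1 f g := u.memH.isWeakDeriv (by norm_num)
  have h2 : IsWeakDeriv 0 1 1 g (weakDeriv 0 1 2 f) :=
    h1.step (u.memH.isWeakDeriv (k := 2) le_rfl)
  have hz : weakDeriv 0 1 2 f = 0 := h
  obtain ⟨C, hC⟩ := ae_const_of_weakDeriv_zero h01 (L2.integrableOn g) (by
    intro φ hφ
    have := h2 φ hφ
    rw [iteratedDeriv_one, hz] at this
    rw [this, integral_congr_ae ((Lp.coeFn_zero ℂ 2 _).mono fun x hx => by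
      simp only [hx, Pi.zero_apply, smul_zero] :
      (fun x => φ x • (0 : L2 0 1) x) =ᵐ[volume.restrict (Ioo 0 1)] fun _ => (0 : ℂ))]
    simp)
  obtain ⟨C', hC'⟩ := (h1.congr_right hC).exists_primitive h01 (L2.integrableOn u.toL2) (by simp)
  have hcont : ContinuousOn (fun x : ℝ => C' + ∫ _t in (0 : ℝ)..x, C) (Icc 0 1) := by
    simp only [intervalIntegral.integral_const, sub_zero]
    fun_prop
  have hv : ∀ x ∈ Icc (0 : ℝ) 1, value 0 1 f x = C' + ∫ _t in (0 : ℝ)..x, C := fun x hx =>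
    HasValue.value_eq h01 hx ⟨_, hcont, hC', rfl⟩
  have e0 := (hv 0 (by simp)).symm.trans u.value_zero
  have e1 := (hv 1 (by simp)).symm.trans u.value_one
  simp only [intervalIntegral.integral_same, add_zero] at e0
  simp only [e0, zero_add, intervalIntegral.integral_const, sub_zero, one_smul] at e1
  apply Disp.toL2_injective
  rw [map_zero]
  refine Lp.ext (hC'.trans ?_)
  refine Filter.EventuallyEq.trans ?_ (Lp.coeFn_zero ℂ 2 _).symm
  exact ae_of_all _ fun x => by simp [e0, e1]

/-- The inner product `a ∫₀¹ u_xx w_xx dx`, conjugate-linear in the first variable (Mathlib's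
convention). -/
abbrev dispCore (p : Params) : InnerProductSpace.Core ℂ p.Disp where
  inner u w := (p.a : ℂ) * inner ℂ u.dxx w.dxx
  conj_inner_symm u w := by simp [inner_conj_symm]
  re_inner_nonneg u := by
    have : 0 ≤ (inner ℂ u.dxx u.dxx).re := inner_self_nonneg (𝕜 := ℂ)
    simpa using mul_nonneg p.a_pos.le this
  add_left u w z := by simp [inner_add_left, mul_add]
  smul_left u w r := by simp [inner_smul_left]; ring
  definite u h := by
    have ha : (p.a : ℂ) ≠ 0 := by exact_mod_cast p.a_pos.ne'
    exact u.eq_zero_of_dxx (inner_self_eq_zero.1 ((mul_eq_zero.1 h).resolve_left ha))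

instance (p : Params) : NormedAddCommGroup p.Disp := (dispCore p).toNormedAddCommGroup

instance (p : Params) : InnerProductSpace ℂ p.Disp := InnerProductSpace.ofCore (dispCore p).toCore

theorem Disp.inner_def (u w : p.Disp) : inner ℂ u w = (p.a : ℂ) * inner ℂ u.dxx w.dxx := rfl

/-- The energy space `(H²(0, 1) ∩ H¹₀(0, 1)) × L²(0, 1)` with the inner product
`∫₀¹ (a u₁_xx u₂_xx + v₁ v₂) dx` (one factor in each term being conjugated). -/
abbrev Energy (p : Params) : Type := WithLp 2 (p.Disp × L2 0 1)

/-- The first component `u` of `U = (u, v)`. -/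
def Energy.u (U : p.Energy) : L2 0 1 := U.fst.toL2

/-- The second component `v` of `U = (u, v)`. -/
def Energy.v (U : p.Energy) : L2 0 1 := U.snd

theorem Energy.memH_u (U : p.Energy) : MemH 2 0 1 U.u := Disp.memH U.fst

theorem Energy.u_add (U W : p.Energy) : (U + W).u = U.u + W.u := map_add _ _ _

theorem Energy.u_smul (r : ℂ) (U : p.Energy) : (r • U).u = r • U.u := map_smul _ _ _

theorem Energy.inner_eq (U W : p.Energy) : inner ℂ U W =
    ∫ x in Ioo (0 : ℝ) 1, ((p.a : ℂ) * (weakDeriv 0 1 2 W.u x *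
      (starRingEnd ℂ) (weakDeriv 0 1 2 U.u x)) + W.v x * (starRingEnd ℂ) (U.v x)) := by
  have h1 := L2.integrable_inner (𝕜 := ℂ) (weakDeriv 0 1 2 U.u) (weakDeriv 0 1 2 W.u)
  have h2 := L2.integrable_inner (𝕜 := ℂ) U.v W.v
  simp only [RCLike.inner_apply] at h1 h2
  rw [integral_add (h1.const_mul _) h2, integral_const_mul]
  rfl

/-- The domain of the beam operator: the pairs `(u, v)` in the energy space (so that already
`u ∈ H²(0, 1)` and `u(0) = u(1) = 0`) with `u ∈ H⁴(0, ξ) ∩ H⁴(ξ, 1)`, `v ∈ H²(0, 1)`,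
`v(0) = v(1) = 0`, `u_xx(0) = u_xx(1) = 0`, `u_xx(ξ⁻) = u_xx(ξ⁺)` and
`u_xxx(ξ⁺) - u_xxx(ξ⁻) = -(α / a) v(ξ)`. -/
structure InDomain (p : Params) (u v : ℝ → ℂ) : Prop where
  left : MemH 4 0 p.ξ u
  right : MemH 4 p.ξ 1 u
  vel : MemH 2 0 1 v
  vel_zero : value 0 1 v 0 = 0
  vel_one : value 0 1 v 1 = 0
  uxx_zero : value 0 p.ξ (weakDeriv 0 p.ξ 2 u) 0 = 0
  uxx_one : value p.ξ 1 (weakDeriv p.ξ 1 2 u) 1 = 0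
  uxx_jump : value 0 p.ξ (weakDeriv 0 p.ξ 2 u) p.ξ = value p.ξ 1 (weakDeriv p.ξ 1 2 u) p.ξ
  uxxx_jump : value p.ξ 1 (weakDeriv p.ξ 1 3 u) p.ξ - value 0 p.ξ (weakDeriv 0 p.ξ 3 u) p.ξ =
    -((p.α / p.a : ℝ) : ℂ) * value 0 1 v p.ξ

theorem ae_restrict_left (p : Params) {f g : ℝ → ℂ} (h : f =ᵐ[volume.restrict (Ioo 0 1)] g) :
    f =ᵐ[volume.restrict (Ioo 0 p.ξ)] g :=
  ae_restrict_of_ae_restrict_of_subset (Ioo_subset_Ioo le_rfl p.ξ_mem.2.le) h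

theorem ae_restrict_right (p : Params) {f g : ℝ → ℂ} (h : f =ᵐ[volume.restrict (Ioo 0 1)] g) :
    f =ᵐ[volume.restrict (Ioo p.ξ 1)] g :=
  ae_restrict_of_ae_restrict_of_subset (Ioo_subset_Ioo p.ξ_mem.1.le le_rfl) h

theorem InDomain.congr {u v u' v' : ℝ → ℂ} (h : p.InDomain u v)
    (hu : u =ᵐ[volume.restrict (Ioo 0 1)] u') (hv : v =ᵐ[volume.restrict (Ioo 0 1)] v') :
    p.InDomain u' v' := by
  have hl := p.ae_restrict_left hu
  have hr := p.ae_restrict_right hu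
  constructor
  · exact h.left.congr hl
  · exact h.right.congr hr
  · exact h.vel.congr hv
  · rw [← value_congr hv, h.vel_zero]
  · rw [← value_congr hv, h.vel_one]
  · rw [← weakDeriv_congr hl, h.uxx_zero]
  · rw [← weakDeriv_congr hr, h.uxx_one]
  · rw [← weakDeriv_congr hl, ← weakDeriv_congr hr, h.uxx_jump]
  · rw [← weakDeriv_congr hl, ← weakDeriv_congr hr, ← value_congr hv, h.uxxx_jump]

theorem InDomain.add {u v u' v' : ℝ → ℂ} (h : p.InDomain u v) (h' : p.InDomain u' v') :
    p.InDomain (fun x => u x + u' x) (fun x => v x + v' x) := by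
  have hξ := p.ξ_mem
  have m0 : (0 : ℝ) ∈ Icc 0 p.ξ := ⟨le_rfl, hξ.1.le⟩
  have m1 : p.ξ ∈ Icc 0 p.ξ := ⟨hξ.1.le, le_rfl⟩
  have m2 : p.ξ ∈ Icc p.ξ 1 := ⟨le_rfl, hξ.2.le⟩
  have m3 : (1 : ℝ) ∈ Icc p.ξ 1 := ⟨hξ.2.le, le_rfl⟩
  have m4 : p.ξ ∈ Icc (0 : ℝ) 1 := ⟨hξ.1.le, hξ.2.le⟩
  have e2 := h.uxx_jump
  have e2' := h'.uxx_jump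
  have e3 := h.uxxx_jump
  have e3' := h'.uxxx_jump
  constructor
  · exact h.left.add h'.left
  · exact h.right.add h'.right
  · exact h.vel.add h'.vel
  · rw [h.vel.value_add zero_lt_one h'.vel (by norm_num) (by simp), h.vel_zero, h'.vel_zero,
      add_zero]
  · rw [h.vel.value_add zero_lt_one h'.vel (by norm_num) (by simp), h.vel_one, h'.vel_one,
      add_zero]
  · rw [h.left.value_weakDeriv_add hξ.1 h'.left (by norm_num) m0, h.uxx_zero, h'.uxx_zero,
      add_zero]
  · rw [h.right.value_weakDeriv_add hξ.2 h'.right (by norm_num) m3, h.uxx_one, h'.uxx_one,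
      add_zero]
  · rw [h.left.value_weakDeriv_add hξ.1 h'.left (by norm_num) m1,
      h.right.value_weakDeriv_add hξ.2 h'.right (by norm_num) m2, e2, e2']
  · rw [h.left.value_weakDeriv_add hξ.1 h'.left (by norm_num) m1,
      h.right.value_weakDeriv_add hξ.2 h'.right (by norm_num) m2,
      h.vel.value_add zero_lt_one h'.vel (by norm_num) m4]
    linear_combination e3 + e3'

theorem InDomain.smul {u v : ℝ → ℂ} (h : p.InDomain u v) (r : ℂ) :
    p.InDomain (fun x => r • u x) (fun x => r • v x) := by
  have hξ := p.ξ_mem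
  have m0 : (0 : ℝ) ∈ Icc 0 p.ξ := ⟨le_rfl, hξ.1.le⟩
  have m1 : p.ξ ∈ Icc 0 p.ξ := ⟨hξ.1.le, le_rfl⟩
  have m2 : p.ξ ∈ Icc p.ξ 1 := ⟨le_rfl, hξ.2.le⟩
  have m3 : (1 : ℝ) ∈ Icc p.ξ 1 := ⟨hξ.2.le, le_rfl⟩
  have m4 : p.ξ ∈ Icc (0 : ℝ) 1 := ⟨hξ.1.le, hξ.2.le⟩
  have e2 := h.uxx_jump
  have e3 := h.uxxx_jump
  constructor
  · exact h.left.smul r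
  · exact h.right.smul r
  · exact h.vel.smul r
  · rw [h.vel.value_smul zero_lt_one r (by norm_num) (by simp), h.vel_zero, smul_zero]
  · rw [h.vel.value_smul zero_lt_one r (by norm_num) (by simp), h.vel_one, smul_zero]
  · rw [h.left.value_weakDeriv_smul hξ.1 r (by norm_num) m0, h.uxx_zero, smul_zero]
  · rw [h.right.value_weakDeriv_smul hξ.2 r (by norm_num) m3, h.uxx_one, smul_zero]
  · rw [h.left.value_weakDeriv_smul hξ.1 r (by norm_num) m1,
      h.right.value_weakDeriv_smul hξ.2 r (by norm_num) m2, e2]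
  · rw [h.left.value_weakDeriv_smul hξ.1 r (by norm_num) m1,
      h.right.value_weakDeriv_smul hξ.2 r (by norm_num) m2,
      h.vel.value_smul zero_lt_one r (by norm_num) m4]
    simp only [smul_eq_mul]
    linear_combination r * e3

theorem InDomain.zero : p.InDomain (fun _ => 0) (fun _ => 0) := by
  have hξ := p.ξ_mem
  have m0 : (0 : ℝ) ∈ Icc 0 p.ξ := ⟨le_rfl, hξ.1.le⟩
  have m1 : p.ξ ∈ Icc 0 p.ξ := ⟨hξ.1.le, le_rfl⟩
  have m2 : p.ξ ∈ Icc p.ξ 1 := ⟨le_rfl, hξ.2.le⟩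
  have m3 : (1 : ℝ) ∈ Icc p.ξ 1 := ⟨hξ.2.le, le_rfl⟩
  have m4 : p.ξ ∈ Icc (0 : ℝ) 1 := ⟨hξ.1.le, hξ.2.le⟩
  constructor
  · exact MemH.zero
  · exact MemH.zero
  · exact MemH.zero
  · exact Beam.value_zero zero_lt_one (by simp)
  · exact Beam.value_zero zero_lt_one (by simp)
  · exact value_weakDeriv_zero hξ.1 m0
  · exact value_weakDeriv_zero hξ.2 m3
  · rw [value_weakDeriv_zero hξ.1 m1, value_weakDeriv_zero hξ.2 m2]
  · rw [value_weakDeriv_zero hξ.1 m1, value_weakDeriv_zero hξ.2 m2,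
      Beam.value_zero zero_lt_one m4]
    simp

/-- The domain `D(𝒜)` as a subspace of the energy space. -/
def domain (p : Params) : Submodule ℂ p.Energy where
  carrier := {U | p.InDomain U.u U.v}
  add_mem' {U W} hU hW := (hU.add hW).congr
    (by rw [Energy.u_add]; exact (Lp.coeFn_add _ _).symm) (Lp.coeFn_add U.v W.v).symm
  zero_mem' := InDomain.zero.congr (Lp.coeFn_zero ℂ 2 _).symm (Lp.coeFn_zero ℂ 2 _).symm
  smul_mem' r U hU := (hU.smul r).congr
    (by rw [Energy.u_smul]; exact (Lp.coeFn_smul r U.u).symm) (Lp.coeFn_smul r U.v).symm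

/-- `g ∈ L²(0, 1)` is the distribution `-a u_xxxx - b v - α v(ξ) δ_ξ` on `(0, 1)`. -/
def IsAccel (p : Params) (u v : ℝ → ℂ) (g : L2 0 1) : Prop :=
  ∀ φ : ℝ → ℝ, IsTest 0 1 φ →
    ∫ x in Ioo 0 1, φ x • g x =
      -(p.a : ℂ) * (∫ x in Ioo 0 1, iteratedDeriv 4 φ x • u x)
        - (p.b : ℂ) * (∫ x in Ioo 0 1, φ x • v x)
        - (p.α : ℂ) * (φ p.ξ • value 0 1 v p.ξ)

theorem IsAccel.unique {u v : ℝ → ℂ} {g g' : L2 0 1} (h : p.IsAccel u v g)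
    (h' : p.IsAccel u v g') : g = g' :=
  Lp.ext (ae_eq_of_test (L2.integrableOn g) (L2.integrableOn g') fun φ hφ =>
    (h φ hφ).trans (h' φ hφ).symm)

theorem integral_split (p : Params) {f : ℝ → ℂ} (hf : IntegrableOn f (Ioo 0 1)) :
    ∫ x in Ioo 0 1, f x = (∫ x in Ioo 0 p.ξ, f x) + ∫ x in Ioo p.ξ 1, f x := by
  have hi := intervalIntegrable_of_Ioo zero_le_one hf
  have hξ := p.ξ_mem
  rw [setIntegral_Ioo zero_le_one, setIntegral_Ioo hξ.1.le, setIntegral_Ioo hξ.2.le,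
    intervalIntegral.integral_add_adjacent_intervals
      (hi.mono_set (uIcc_subset_uIcc_left ?_)) (hi.mono_set (uIcc_subset_uIcc_right ?_))]
  all_goals rw [uIcc_of_le zero_le_one]; exact ⟨hξ.1.le, hξ.2.le⟩

/-- For `(u, v)` in the domain, the fourth derivative of `u` on `(0, 1)` has at `ξ` exactly the
Dirac part that cancels `α v(ξ) δ_ξ`, so that the acceleration is in `L²(0, 1)`. -/
theorem exists_isAccel {u v : ℝ → ℂ} (hu : MemH 2 0 1 u) (h : p.InDomain u v) :
    ∃ g : L2 0 1, p.IsAccel u v g := by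
  have hξ := p.ξ_mem
  have ha : (p.a : ℂ) ≠ 0 := by exact_mod_cast p.a_pos.ne'
  set q₁ : L2 0 p.ξ := weakDeriv 0 p.ξ 4 u
  set q₂ : L2 p.ξ 1 := weakDeriv p.ξ 1 4 u
  have hL : MemLp ((Ioo 0 p.ξ).indicator q₁) 2 (volume.restrict (Ioo (0 : ℝ) 1)) := by
    rw [memLp_indicator_iff_restrict measurableSet_Ioo,
      Measure.restrict_restrict measurableSet_Ioo,
      inter_eq_left.2 (Ioo_subset_Ioo le_rfl hξ.2.le)]
    exact Lp.memLp q₁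
  have hR : MemLp ((Ioo p.ξ 1).indicator q₂) 2 (volume.restrict (Ioo (0 : ℝ) 1)) := by
    rw [memLp_indicator_iff_restrict measurableSet_Ioo,
      Measure.restrict_restrict measurableSet_Ioo,
      inter_eq_left.2 (Ioo_subset_Ioo hξ.1.le le_rfl)]
    exact Lp.memLp q₂
  have hG := ((hL.add hR).const_smul (-(p.a : ℂ))).sub (h.vel.1.const_smul (p.b : ℂ))
  refine ⟨hG.toLp _, fun φ hφ => ?_⟩
  have hLR := memLp_integrableOn (hL.add hR)
  have hv := memLp_integrableOn h.vel.1
  have i1 : Integrable (fun x => -(p.a : ℂ) * (φ x • ((Ioo 0 p.ξ).indicator q₁ +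
      (Ioo p.ξ 1).indicator q₂) x)) (volume.restrict (Ioo 0 1)) :=
    (hφ.integrable_smul hLR).const_mul _
  have i2 : Integrable (fun x => (p.b : ℂ) * (φ x • v x)) (volume.restrict (Ioo 0 1)) :=
    (hφ.integrable_smul hv).const_mul _
  have e1 : ∫ x in Ioo 0 1, φ x • (hG.toLp _) x =
      -(p.a : ℂ) * (∫ x in Ioo 0 1, φ x • ((Ioo 0 p.ξ).indicator q₁ +
        (Ioo p.ξ 1).indicator q₂) x) - (p.b : ℂ) * ∫ x in Ioo 0 1, φ x • v x := by
    rw [← integral_const_mul, ← integral_const_mul, ← integral_sub i1 i2]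
    refine integral_congr_ae (hG.coeFn_toLp.mono fun x hx => ?_)
    simp only [hx, Pi.sub_apply, Pi.smul_apply, smul_eq_mul, smul_sub, Complex.real_smul]
    ring
  have e2 : ∫ x in Ioo 0 1, φ x • ((Ioo 0 p.ξ).indicator q₁ + (Ioo p.ξ 1).indicator q₂) x =
      (∫ x in Ioo 0 p.ξ, φ x • q₁ x) + ∫ x in Ioo p.ξ 1, φ x • q₂ x := by
    rw [p.integral_split (hφ.integrable_smul hLR)]
    congr 1
    · refine setIntegral_congr_fun measurableSet_Ioo fun x hx => ?_
      have : x ∉ Ioo p.ξ 1 := fun h' => (h'.1.trans hx.2).false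
      simp [indicator_of_mem hx, indicator_of_notMem this]
    · refine setIntegral_congr_fun measurableSet_Ioo fun x hx => ?_
      have : x ∉ Ioo 0 p.ξ := fun h' => (h'.2.trans hx.1).false
      simp [indicator_of_mem hx, indicator_of_notMem this]
  have hu2 : IsWeakDeriv 0 1 2 u (weakDeriv 0 1 2 u) := hu.isWeakDeriv le_rfl
  have e3 : ∫ x in Ioo 0 1, iteratedDeriv 4 φ x • u x =
      ∫ x in Ioo 0 1, deriv (deriv φ) x • weakDeriv 0 1 2 u x := by
    have := hu2 _ hφ.test_deriv.test_deriv
    rw [← iteratedDeriv_succ', ← iteratedDeriv_succ'] at this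
    rw [this]; norm_num
  have hdd := hφ.test_deriv.test_deriv
  have l2 : (weakDeriv 0 1 2 u : ℝ → ℂ) =ᵐ[volume.restrict (Ioo 0 p.ξ)] weakDeriv 0 p.ξ 2 u :=
    (hu2.mono le_rfl hξ.2.le).unique (h.left.isWeakDeriv (by norm_num))
      ((L2.integrableOn _).mono_set (Ioo_subset_Ioo le_rfl hξ.2.le)) (L2.integrableOn _)
  have r2 : (weakDeriv 0 1 2 u : ℝ → ℂ) =ᵐ[volume.restrict (Ioo p.ξ 1)] weakDeriv p.ξ 1 2 u :=
    (hu2.mono hξ.1.le le_rfl).unique (h.right.isWeakDeriv (by norm_num))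
      ((L2.integrableOn _).mono_set (Ioo_subset_Ioo hξ.1.le le_rfl)) (L2.integrableOn _)
  have e4 : ∫ x in Ioo 0 1, deriv (deriv φ) x • weakDeriv 0 1 2 u x =
      (∫ x in Ioo 0 p.ξ, deriv (deriv φ) x • weakDeriv 0 p.ξ 2 u x) +
        ∫ x in Ioo p.ξ 1, deriv (deriv φ) x • weakDeriv p.ξ 1 2 u x := by
    rw [p.integral_split (hdd.integrable_smul (L2.integrableOn _))]
    congr 1
    · exact integral_congr_ae (l2.mono fun x hx => by simp only [hx])
    · exact integral_congr_ae (r2.mono fun x hx => by simp only [hx])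
  have j2 := h.uxx_jump
  have j3 := h.uxxx_jump
  rw [e1, e2, e3, e4, h.left.integral_deriv_deriv_smul hξ.1 hφ.1,
    h.right.integral_deriv_deriv_smul hξ.2 hφ.1, hφ.eq_zero (x := 0) (by simp),
    hφ.eq_zero (x := 1) (by simp), hφ.test_deriv.eq_zero (x := 0) (by simp),
    hφ.test_deriv.eq_zero (x := 1) (by simp), j2]
  have j3' : (p.a : ℂ) * (value p.ξ 1 (weakDeriv p.ξ 1 3 u) p.ξ
      - value 0 p.ξ (weakDeriv 0 p.ξ 3 u) p.ξ) = -(p.α : ℂ) * value 0 1 v p.ξ := by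
    rw [j3]; push_cast; field_simp
  simp only [Complex.real_smul, zero_smul, q₁, q₂]
  linear_combination (φ p.ξ : ℂ) * j3'

/-- The function `-a u_xxxx - b v - α v(ξ) δ_ξ ∈ L²(0, 1)` for `U = (u, v) ∈ D(𝒜)`. -/
def accel (U : p.domain) : L2 0 1 := (exists_isAccel (Energy.memH_u U.1) U.2).choose

theorem isAccel_accel (U : p.domain) : p.IsAccel U.1.u U.1.v (accel U) :=
  (exists_isAccel (Energy.memH_u U.1) U.2).choose_spec

/-- The velocity `v` of an element of the domain, as an element of `H²(0, 1) ∩ H¹₀(0, 1)`. -/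
def velocity (U : p.domain) : p.Disp := ⟨U.1.v, U.2.vel, U.2.vel_zero, U.2.vel_one⟩

theorem accel_add (U W : p.domain) : accel (U + W) = accel U + accel W := by
  refine (isAccel_accel (U + W)).unique fun φ hφ => ?_
  have hU := isAccel_accel U φ hφ
  have hW := isAccel_accel W φ hφ
  have h4 := hφ.test_iteratedDeriv 4
  have m4 : p.ξ ∈ Icc (0 : ℝ) 1 := ⟨p.ξ_mem.1.le, p.ξ_mem.2.le⟩
  have a1 : ∀ (χ : ℝ → ℝ), IsTest 0 1 χ → ∀ f g : L2 0 1,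
      ∫ x in Ioo 0 1, χ x • (f + g : L2 0 1) x =
        (∫ x in Ioo 0 1, χ x • f x) + ∫ x in Ioo 0 1, χ x • g x := fun χ hχ f g => by
    rw [← integral_add (hχ.integrable_smul (L2.integrableOn f))
      (hχ.integrable_smul (L2.integrableOn g))]
    exact integral_congr_ae ((Lp.coeFn_add f g).mono fun x hx => by
      simp only [hx, Pi.add_apply, smul_add])
  have ev : value 0 1 (U + W : p.domain).1.v p.ξ = value 0 1 U.1.v p.ξ + value 0 1 W.1.v p.ξ := by
    rw [← U.2.vel.value_add zero_lt_one W.2.vel (by norm_num) m4]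
    exact value_congr (Lp.coeFn_add U.1.v W.1.v)
  have eu : (U + W : p.domain).1.u = U.1.u + W.1.u := Energy.u_add _ _
  have ev' : (U + W : p.domain).1.v = U.1.v + W.1.v := rfl
  rw [ev, eu, ev', a1 _ hφ, a1 _ h4, a1 _ hφ, hU, hW, smul_add]
  ring

theorem accel_smul (r : ℂ) (U : p.domain) : accel (r • U) = r • accel U := by
  refine (isAccel_accel (r • U)).unique fun φ hφ => ?_
  have hU := isAccel_accel U φ hφ
  have m4 : p.ξ ∈ Icc (0 : ℝ) 1 := ⟨p.ξ_mem.1.le, p.ξ_mem.2.le⟩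
  have a1 : ∀ (χ : ℝ → ℝ) (f : L2 0 1), ∫ x in Ioo 0 1, χ x • (r • f : L2 0 1) x =
      r * ∫ x in Ioo 0 1, χ x • f x := fun χ f => by
    rw [← integral_const_mul]
    exact integral_congr_ae ((Lp.coeFn_smul r f).mono fun x hx => by
      simp only [hx, Pi.smul_apply, smul_eq_mul, Complex.real_smul]; ring)
  have ev : value 0 1 (r • U : p.domain).1.v p.ξ = r * value 0 1 U.1.v p.ξ := by
    rw [← smul_eq_mul, ← U.2.vel.value_smul zero_lt_one r (by norm_num) m4]
    exact value_congr (Lp.coeFn_smul r U.1.v)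
  have eu : (r • U : p.domain).1.u = r • U.1.u := Energy.u_smul _ _
  have ev' : (r • U : p.domain).1.v = r • U.1.v := rfl
  rw [ev, eu, ev', a1, a1, a1, hU]
  simp only [Complex.real_smul]
  ring

/-- The beam operator `𝒜 (u, v) = (v, -a u_xxxx - b v - α v(ξ) δ_ξ)` on the energy space. -/
def operator (p : Params) : p.Energy →ₗ.[ℂ] p.Energy where
  domain := p.domain
  toFun :=
    { toFun := fun U => WithLp.toLp 2 (velocity U, accel U)
      map_add' := fun U W => by rw [accel_add]; rfl
      map_smul' := fun r U => by rw [accel_smul]; rfl }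

end Params

end Beam

/-- An unbounded operator `A` on a complex inner product space is dissipative if
`Re ⟨A x, x⟩ ≤ 0` for every `x` in its domain. -/
def LinearPMap.IsDissipative {E : Type*} [NormedAddCommGroup E] [InnerProductSpace ℂ E]
    (A : E →ₗ.[ℂ] E) : Prop :=
  ∀ x : A.domain, (inner ℂ (x : E) (A x)).re ≤ 0

/-- `A` is m-dissipative if it is dissipative and `μ - A` is onto for every `μ > 0`. -/
def LinearPMap.IsMDissipative {E : Type*} [NormedAddCommGroup E] [InnerProductSpace ℂ E]
    (A : E →ₗ.[ℂ] E) : Prop :=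
  A.IsDissipative ∧
    ∀ μ : ℝ, 0 < μ → Function.Surjective fun x : A.domain => (μ : ℂ) • (x : E) - A x

end

/-!
On `L²(0, 1)` let `G` be the bounded self-adjoint inverse of the Dirichlet second derivative, with
kernel the Green function `k_x`, so that an `f ∈ H² ∩ H¹₀` satisfies `f = G f_xx` and
`f(x) = ⟨k_x, f_xx⟩`. The transmission and boundary conditions of `D(𝒜)` say exactly that the
corrected bending moment `a u_xx + α v(ξ) k_ξ` lies in `H² ∩ H¹₀`, and `𝒜 (u, v) = (v, g)` becomes
`a u_xx + α v(ξ) k_ξ = -G (g + b v)`. Pairing this identity with `v_xx` gives the dissipation law.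
Substituting `v = l u - f` into it turns the resolvent equation `l U - 𝒜 U = (f, g)` into
`(a + l S) u_xx = G g + S f_xx` with `S = α ⟨k_ξ, ·⟩ k_ξ + (l + b) G² ≥ 0`, which is solvable for
every `l ≥ 0` because `a > 0`.
-/

noncomputable section

namespace Beam

theorem memLp_of_continuousOn {c d : ℝ} {f : ℝ → ℂ} (hf : ContinuousOn f (Icc c d)) :
    MemLp f 2 (volume.restrict (Ioo c d)) := by
  obtain ⟨C, hC⟩ := isCompact_Icc.exists_bound_of_continuousOn hf
  refine MemLp.of_bound
    ((hf.mono Ioo_subset_Icc_self).aestronglyMeasurable measurableSet_Ioo) C ?_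
  exact (ae_restrict_mem measurableSet_Ioo).mono fun x hx => hC x (Ioo_subset_Icc_self hx)

theorem integrableOn_of_continuousOn {c d : ℝ} {f : ℝ → ℂ} (hf : ContinuousOn f (Icc c d)) :
    IntegrableOn f (Ioo c d) :=
  memLp_integrableOn (memLp_of_continuousOn hf)

theorem continuousOn_primitive {c d : ℝ} (hcd : c ≤ d) {g : ℝ → ℂ}
    (hg : IntegrableOn g (Ioo c d)) : ContinuousOn (fun x => ∫ t in c..x, g t) (Icc c d) := by
  rw [← uIcc_of_le hcd]
  exact intervalIntegral.continuousOn_primitive_interval' (intervalIntegrable_of_Ioo hcd hg)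
    left_mem_uIcc

theorem HasValue.mono {c d c' d' x : ℝ} {f : ℝ → ℂ} {z : ℂ} (h : HasValue c d f x z)
    (hc : c ≤ c') (hd : d' ≤ d) : HasValue c' d' f x z := by
  obtain ⟨g, hg, hfg, hz⟩ := h
  exact ⟨g, hg.mono (Icc_subset_Icc hc hd),
    ae_restrict_of_ae_restrict_of_subset (Ioo_subset_Ioo hc hd) hfg, hz⟩

theorem hasValue_of_continuousOn {c d x : ℝ} {f : ℝ → ℂ} (hf : ContinuousOn f (Icc c d)) :
    HasValue c d f x (f x) :=
  ⟨f, hf, EventuallyEq.rfl, rfl⟩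

theorem isWeakDeriv_zero (c d : ℝ) (f : ℝ → ℂ) : IsWeakDeriv c d 0 f f := by
  intro φ _
  simp only [iteratedDeriv_zero, pow_zero, one_mul]

theorem IsWeakDeriv.trans {c d : ℝ} {j k : ℕ} {f g h : ℝ → ℂ} (hfg : IsWeakDeriv c d j f g)
    (hgh : IsWeakDeriv c d k g h) : IsWeakDeriv c d (j + k) f h := by
  intro φ hφ
  have hiter : iteratedDeriv (j + k) φ = iteratedDeriv j (iteratedDeriv k φ) := by
    simp only [iteratedDeriv_eq_iterate, Function.iterate_add_apply]
  rw [hiter, hfg _ (hφ.test_iteratedDeriv k), hgh φ hφ, pow_add, mul_assoc]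

theorem isWeakDeriv_primitive {c d : ℝ} (hcd : c ≤ d) {g : ℝ → ℂ} (hg : IntegrableOn g (Ioo c d))
    (C : ℂ) : IsWeakDeriv c d 1 (fun x => C + ∫ t in c..x, g t) g := by
  intro φ hφ
  have hgi := intervalIntegrable_of_Ioo hcd hg
  have hderiv : IntervalIntegrable (deriv φ) volume c d :=
    hφ.test_deriv.1.continuous.intervalIntegrable _ _
  have hconst : ∫ x in c..d, deriv φ x • C = 0 := by
    rw [intervalIntegral.integral_smul_const, intervalIntegral.integral_deriv_eq_sub
      (fun x _ => hφ.1.differentiable (by simp) x) hderiv, hφ.eq_zero (x := c) (by simp),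
      hφ.eq_zero (x := d) (by simp), sub_zero, zero_smul]
  have hprim := hφ.test_deriv.integrable_smul
    (integrableOn_of_continuousOn (continuousOn_primitive hcd hg))
  simp only [iteratedDeriv_one, smul_add]
  rw [integral_add (hφ.test_deriv.integrable_smul (by simp)) hprim, setIntegral_Ioo hcd,
    setIntegral_Ioo hcd, setIntegral_Ioo hcd, hconst, ibp hφ.1 hgi, hφ.eq_zero (x := d) (by simp)]
  simp

theorem isWeakDeriv_affine {c d : ℝ} (hcd : c ≤ d) (A B : ℂ) :
    IsWeakDeriv c d 1 (fun x : ℝ => A + x * B) fun _ => B := by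
  have h := isWeakDeriv_primitive hcd (g := fun _ => B) (by simp) (A + c * B)
  have heq : (fun x : ℝ => A + c * B + ∫ _ in c..x, B) = fun x : ℝ => A + x * B := by
    funext x
    rw [intervalIntegral.integral_const, Complex.real_smul, Complex.ofReal_sub]
    ring
  rwa [heq] at h

theorem IsTest.exists_eq_deriv_add {c d : ℝ} {φ ψ : ℝ → ℝ} (hφ : IsTest c d φ)
    (hψ : IsTest c d ψ) (hψ1 : ∫ x in c..d, ψ x = 1) :
    ∃ Φ, IsTest c d Φ ∧ φ = fun x => deriv Φ x + (∫ t in c..d, φ t) * ψ x := by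
  set m := ∫ t in c..d, φ t
  have htest : IsTest c d (φ - fun x => m * ψ x) := by
    refine ⟨hφ.1.sub (contDiff_const.mul hψ.1), ?_, ?_⟩
    · rw [sub_eq_add_neg]
      exact hφ.2.1.add hψ.2.1.mul_left.neg
    · exact (tsupport_sub _ _).trans
        (union_subset hφ.2.2 (tsupport_mul_subset_right.trans hψ.2.2))
  obtain ⟨Φ, hΦ, hΦ'⟩ := htest.primitive (by
    simp only [Pi.sub_apply]
    rw [intervalIntegral.integral_sub (hφ.1.continuous.intervalIntegrable _ _)
      ((hψ.1.continuous.const_mul m).intervalIntegrable _ _),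
      intervalIntegral.integral_const_mul, hψ1, mul_one, sub_self])
  exact ⟨Φ, hΦ, by simp [hΦ']⟩

theorem IsTest.integral_iteratedDeriv_smul_deriv_add {c d : ℝ} {Φ ψ : ℝ → ℝ} (hΦ : IsTest c d Φ)
    (hψ : IsTest c d ψ) (m : ℝ) (k : ℕ) {f : ℝ → ℂ} (hf : IntegrableOn f (Ioo c d)) :
    ∫ x in Ioo c d, iteratedDeriv k (fun t => deriv Φ t + m * ψ t) x • f x =
      (∫ x in Ioo c d, iteratedDeriv (k + 1) Φ x • f x) +
        m * ∫ x in Ioo c d, iteratedDeriv k ψ x • f x := by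
  have hderiv (x : ℝ) : iteratedDeriv k (fun t => deriv Φ t + m * ψ t) x =
      iteratedDeriv (k + 1) Φ x + m * iteratedDeriv k ψ x := by
    rw [iteratedDeriv_fun_add, iteratedDeriv_const_mul_field, iteratedDeriv_succ']
    · exact hΦ.test_deriv.1.contDiffAt.of_le (by exact_mod_cast le_top)
    · exact (contDiff_const.mul hψ.1).contDiffAt.of_le (by exact_mod_cast le_top)
  simp only [hderiv, add_smul, mul_smul]
  rw [integral_add, integral_smul, Complex.real_smul]
  · exact (hΦ.test_iteratedDeriv _).integrable_smul hf
  · exact ((hψ.test_iteratedDeriv k).integrable_smul hf).smul m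

theorem IsWeakDeriv.exists_primitive_of_succ {c d : ℝ} (hcd : c < d) {k : ℕ} {f g : ℝ → ℂ}
    (h : IsWeakDeriv c d (k + 1) f g) (hf : IntegrableOn f (Ioo c d))
    (hg : IntegrableOn g (Ioo c d)) :
    ∃ C : ℂ, IsWeakDeriv c d k f fun x => C + ∫ t in c..x, g t := by
  obtain ⟨ψ, hψ, hψ1⟩ := exists_test_integral_one hcd
  set P : ℝ → ℂ := fun x => ∫ t in c..x, g t with hP
  have hPi : IntegrableOn P (Ioo c d) :=
    integrableOn_of_continuousOn (continuousOn_primitive hcd.le hg)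
  refine ⟨(-1) ^ k * (∫ x in Ioo c d, iteratedDeriv k ψ x • f x) - ∫ x in Ioo c d, ψ x • P x,
    fun φ hφ => ?_⟩
  obtain ⟨Φ, hΦ, hφΦ⟩ := hφ.exists_eq_deriv_add hψ hψ1
  have hf_eq := hΦ.integral_iteratedDeriv_smul_deriv_add hψ (∫ t in c..d, φ t) k hf
  have hP_eq := hΦ.integral_iteratedDeriv_smul_deriv_add hψ (∫ t in c..d, φ t) 0 hPi
  rw [← hφΦ] at hf_eq hP_eq
  have hΦP : ∫ x in Ioo c d, deriv Φ x • P x = -∫ x in Ioo c d, Φ x • g x := by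
    simpa [hP] using isWeakDeriv_primitive hcd.le hg 0 Φ hΦ
  have hmean : ∫ x in Ioo c d, φ x = ∫ t in c..d, φ t := by
    rw [intervalIntegral.integral_of_le hcd.le, integral_Ioc_eq_integral_Ioo]
  have hsq : ((-1) ^ k * (-1) ^ k : ℂ) = 1 := by rw [← mul_pow]; simp
  simp only [iteratedDeriv_zero, zero_add, iteratedDeriv_one] at hP_eq
  simp only [smul_add]
  rw [integral_add (hφ.integrable_smul (by simp)) (hφ.integrable_smul hPi), integral_smul_const,
    hmean, Complex.real_smul, hf_eq, h Φ hΦ, hP_eq, hΦP]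
  linear_combination
    -((∫ t in c..d, φ t : ℝ) : ℂ) * (∫ x in Ioo c d, iteratedDeriv k ψ x • f x) * hsq

theorem memH_zero_of_memLp {c d : ℝ} {f : ℝ → ℂ} (hf : MemLp f 2 (volume.restrict (Ioo c d))) :
    MemH 0 c d f :=
  ⟨hf, fun k hk => ⟨hf.toLp f, by
    obtain rfl : k = 0 := Nat.le_zero.1 hk
    exact (isWeakDeriv_zero c d f).congr_right hf.coeFn_toLp.symm⟩⟩

theorem IsWeakDeriv.memH {c d : ℝ} (hcd : c < d) {m : ℕ} {f g : ℝ → ℂ} (h : IsWeakDeriv c d m f g)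
    (hf : MemLp f 2 (volume.restrict (Ioo c d))) (hg : MemLp g 2 (volume.restrict (Ioo c d))) :
    MemH m c d f := by
  induction m generalizing g with
  | zero => exact memH_zero_of_memLp hf
  | succ m ih =>
    obtain ⟨C, hC⟩ := h.exists_primitive_of_succ hcd (memLp_integrableOn hf) (memLp_integrableOn hg)
    have hlower := ih hC (memLp_of_continuousOn
      (continuousOn_const.add (continuousOn_primitive hcd.le (memLp_integrableOn hg))))
    refine ⟨hf, fun k hk => ?_⟩
    obtain hkm | rfl := Nat.le_succ_iff.1 hk
    · exact hlower.2 k hkm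
    · exact ⟨hg.toLp g, h.congr_right hg.coeFn_toLp.symm⟩

theorem IsWeakDeriv.weakDeriv_ae_eq {k : ℕ} {c d : ℝ} {f g : ℝ → ℂ} (h : IsWeakDeriv c d k f g)
    (hg : MemLp g 2 (volume.restrict (Ioo c d))) :
    weakDeriv c d k f =ᵐ[volume.restrict (Ioo c d)] g := by
  rw [(h.congr_right hg.coeFn_toLp.symm : IsWeakDeriv c d k f (hg.toLp g)).weakDeriv_eq]
  exact hg.coeFn_toLp

theorem MemH.value_mono {m : ℕ} {c d c' d' x : ℝ} {f : ℝ → ℂ} (h : MemH m c d f) (hm : 1 ≤ m)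
    (hc : c ≤ c') (hd : d' ≤ d) (hcd : c' < d') (hx : x ∈ Icc c' d') :
    value c' d' f x = value c d f x :=
  ((h.hasValue ((hc.trans_lt hcd).trans_le hd) hm (Icc_subset_Icc hc hd hx)).mono hc hd).value_eq
    hcd hx

theorem exists_ae_eq_affine_of_weakDeriv_two_zero {c d : ℝ} (hcd : c < d) {f : ℝ → ℂ}
    (hf : IntegrableOn f (Ioo c d)) (h : IsWeakDeriv c d 2 f fun _ => 0) :
    ∃ A B : ℂ, f =ᵐ[volume.restrict (Ioo c d)] fun x => A + x * B := by
  obtain ⟨B, hB⟩ := h.exists_primitive_of_succ hcd hf (by simp)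
  simp only [intervalIntegral.integral_zero, add_zero] at hB
  obtain ⟨A, hA⟩ := hB.exists_primitive hcd hf (by simp)
  refine ⟨A - c * B, B, hA.trans (Eventually.of_forall fun x => ?_)⟩
  simp only [intervalIntegral.integral_const, Complex.real_smul, Complex.ofReal_sub]
  ring

theorem ae_eq_zero_of_weakDeriv_two_zero {c d : ℝ} (hcd : c < d) {f : ℝ → ℂ}
    (hf : IntegrableOn f (Ioo c d)) (h : IsWeakDeriv c d 2 f fun _ => 0)
    (hc : HasValue c d f c 0) (hd : HasValue c d f d 0) :
    f =ᵐ[volume.restrict (Ioo c d)] fun _ => 0 := by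
  obtain ⟨A, B, hAB⟩ := exists_ae_eq_affine_of_weakDeriv_two_zero hcd hf h
  have hvalue (x : ℝ) : HasValue c d f x (A + x * B) := ⟨_, by fun_prop, hAB, rfl⟩
  have hAc := hc.unique hcd (left_mem_Icc.2 hcd.le) (hvalue c)
  have hAd := hd.unique hcd (right_mem_Icc.2 hcd.le) (hvalue d)
  have hlen : (d : ℂ) - c ≠ 0 := sub_ne_zero.2 (Complex.ofReal_injective.ne hcd.ne')
  have hB : B = 0 := by
    refine (mul_eq_zero.1 (?_ : ((d : ℂ) - c) * B = 0)).resolve_left hlen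
    linear_combination hAc - hAd
  have hA : A = 0 := by simpa [hB] using hAc.symm
  simpa [hA, hB] using hAB

/-- The integral operator on `(c, d)` with real kernel `K`, acting on functions. -/
def kernelTransform (K : ℝ → ℝ → ℝ) (c d : ℝ) (f : ℝ → ℂ) (x : ℝ) : ℂ :=
  ∫ t in Ioo c d, K x t • f t

section Kernel

variable {K : ℝ → ℝ → ℝ} {c d : ℝ} {f g : ℝ → ℂ}

theorem kernelTransform_congr (hfg : f =ᵐ[volume.restrict (Ioo c d)] g) :
    kernelTransform K c d f = kernelTransform K c d g :=
  funext fun x => integral_congr_ae (hfg.mono fun t ht => congrArg (K x t • ·) ht)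

theorem kernelTransform_conj (x : ℝ) :
    kernelTransform K c d (fun t => (starRingEnd ℂ) (f t)) x =
      (starRingEnd ℂ) (kernelTransform K c d f x) := by
  rw [kernelTransform, kernelTransform, ← integral_conj]
  simp only [Complex.real_smul, map_mul, Complex.conj_ofReal]

theorem exists_kernel_bound (hK : Continuous (Function.uncurry K)) (c d : ℝ) :
    ∃ C, ∀ x ∈ Icc c d, ∀ t ∈ Icc c d, ‖K x t‖ ≤ C := by
  obtain ⟨C, hC⟩ := (isCompact_Icc.prod isCompact_Icc).exists_bound_of_continuousOn
    (hK.continuousOn (s := Icc c d ×ˢ Icc c d))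
  exact ⟨C, fun x hx t ht => hC (x, t) ⟨hx, ht⟩⟩

theorem integrable_kernel_smul (hK : Continuous (Function.uncurry K))
    (hf : IntegrableOn f (Ioo c d)) (x : ℝ) :
    Integrable (fun t => K x t • f t) (volume.restrict (Ioo c d)) := by
  have hKx : Continuous (K x) := hK.uncurry_left x
  obtain ⟨C, hC⟩ := isCompact_Icc.exists_bound_of_continuousOn (hKx.continuousOn (s := Icc c d))
  exact Integrable.bdd_smul (C := C) hf hKx.aestronglyMeasurable
    ((ae_restrict_mem measurableSet_Ioo).mono fun t ht => hC t (Ioo_subset_Icc_self ht))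

theorem kernelTransform_add (hK : Continuous (Function.uncurry K))
    (hf : IntegrableOn f (Ioo c d)) (hg : IntegrableOn g (Ioo c d)) (x : ℝ) :
    kernelTransform K c d (fun t => f t + g t) x =
      kernelTransform K c d f x + kernelTransform K c d g x := by
  simp only [kernelTransform, smul_add]
  exact integral_add (integrable_kernel_smul hK hf x) (integrable_kernel_smul hK hg x)

theorem kernelTransform_smul (r : ℂ) (x : ℝ) :
    kernelTransform K c d (fun t => r • f t) x = r • kernelTransform K c d f x := by
  simp only [kernelTransform, smul_comm _ r]
  exact integral_smul r _

theorem continuousOn_kernelTransform (hK : Continuous (Function.uncurry K))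
    (hf : IntegrableOn f (Ioo c d)) : ContinuousOn (kernelTransform K c d f) (Icc c d) := by
  obtain ⟨C, hC⟩ := exists_kernel_bound hK c d
  refine continuousOn_of_dominated (bound := fun t => C * ‖f t‖)
    (fun x _ => (integrable_kernel_smul hK hf x).aestronglyMeasurable) (fun x hx => ?_)
    (hf.norm.const_mul C) (Eventually.of_forall fun t => ?_)
  · filter_upwards [ae_restrict_mem measurableSet_Ioo] with t ht
    rw [norm_smul]
    exact mul_le_mul_of_nonneg_right (hC x hx t (Ioo_subset_Icc_self ht)) (norm_nonneg _)
  · exact ((hK.uncurry_right t).smul continuous_const).continuousOn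

theorem integral_mul_kernelTransform (hK : Continuous (Function.uncurry K))
    (hsymm : ∀ x t, K x t = K t x) (hf : IntegrableOn f (Ioo c d))
    (hg : IntegrableOn g (Ioo c d)) :
    ∫ x in Ioo c d, f x * kernelTransform K c d g x =
      ∫ x in Ioo c d, kernelTransform K c d f x * g x := by
  obtain ⟨C, hC⟩ := exists_kernel_bound hK c d
  have hint : Integrable (Function.uncurry fun x t => K x t • (f x * g t))
      ((volume.restrict (Ioo c d)).prod (volume.restrict (Ioo c d))) := by
    refine Integrable.bdd_smul (C := C) (hf.mul_prod hg) hK.aestronglyMeasurable ?_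
    rw [Measure.prod_restrict]
    filter_upwards [ae_restrict_mem (measurableSet_Ioo.prod measurableSet_Ioo)] with z hz
    exact hC z.1 (Ioo_subset_Icc_self hz.1) z.2 (Ioo_subset_Icc_self hz.2)
  calc ∫ x in Ioo c d, f x * kernelTransform K c d g x
      = ∫ x in Ioo c d, ∫ t in Ioo c d, K x t • (f x * g t) := by
        simp only [kernelTransform, ← integral_const_mul, mul_smul_comm]
    _ = ∫ t in Ioo c d, ∫ x in Ioo c d, K x t • (f x * g t) := integral_integral_swap hint
    _ = ∫ t in Ioo c d, kernelTransform K c d f t * g t := by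
        simp only [kernelTransform, ← integral_mul_const, smul_mul_assoc, hsymm]

end Kernel

/-- The Dirichlet Green function of the second derivative on `(c, d)`, with the sign for which
its second derivative is `δ_x` (so it is nonpositive). -/
def greenKernel (c d x t : ℝ) : ℝ := (x - c) * (t - c) / (d - c) - (min x t - c)

theorem continuous_greenKernel (c d : ℝ) : Continuous (Function.uncurry (greenKernel c d)) := by
  unfold greenKernel Function.uncurry
  fun_prop

theorem greenKernel_comm (c d x t : ℝ) : greenKernel c d x t = greenKernel c d t x := by
  rw [greenKernel, greenKernel, mul_comm (x - c), min_comm]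

theorem greenKernel_left {c d t : ℝ} (ht : t ∈ Icc c d) : greenKernel c d c t = 0 := by
  simp [greenKernel, ht.1]

theorem greenKernel_right {c d t : ℝ} (hcd : c < d) (ht : t ∈ Icc c d) :
    greenKernel c d d t = 0 := by
  have hlen : d - c ≠ 0 := (sub_pos.2 hcd).ne'
  rw [greenKernel, min_eq_right ht.2, mul_div_cancel_left₀ _ hlen, sub_self]

theorem integral_sub_mul_deriv_deriv {φ : ℝ → ℝ} (hφ : ContDiff ℝ 2 φ) (c x : ℝ) :
    ∫ t in c..x, (t - c) * deriv (deriv φ) t = (x - c) * deriv φ x - φ x + φ c := by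
  have hφ' : ContDiff ℝ 1 (deriv φ) := hφ.deriv' (n := 1)
  have hderiv (t : ℝ) :
      HasDerivAt (fun s => (s - c) * deriv φ s - φ s) ((t - c) * deriv (deriv φ) t) t := by
    refine ((((hasDerivAt_id' t).sub_const c).mul
      (hφ'.differentiable one_ne_zero t).hasDerivAt).sub
      (hφ.differentiable two_ne_zero t).hasDerivAt).congr_deriv ?_
    ring
  rw [intervalIntegral.integral_eq_sub_of_hasDerivAt (fun t _ => hderiv t)
    ((Continuous.mul (by fun_prop) (hφ'.continuous_deriv le_rfl)).intervalIntegrable _ _)]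
  ring

theorem integral_greenKernel_mul_deriv_deriv {c d x : ℝ} (hcd : c < d) (hx : x ∈ Icc c d)
    {φ : ℝ → ℝ} (hφ : ContDiff ℝ 2 φ) (hc : φ c = 0) (hd : φ d = 0) :
    ∫ t in c..d, greenKernel c d x t * deriv (deriv φ) t = φ x := by
  have hφ' : ContDiff ℝ 1 (deriv φ) := hφ.deriv' (n := 1)
  have hcont : Continuous (deriv (deriv φ)) := hφ'.continuous_deriv le_rfl
  have hlen : d - c ≠ 0 := (sub_pos.2 hcd).ne'
  have hleft : ∫ t in c..x, (min x t - c) * deriv (deriv φ) t = (x - c) * deriv φ x - φ x := by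
    rw [← add_zero (_ - φ x), ← hc, ← integral_sub_mul_deriv_deriv hφ]
    refine intervalIntegral.integral_congr fun t ht => ?_
    rw [uIcc_of_le hx.1] at ht
    simp only [min_eq_right ht.2]
  have hright : ∫ t in x..d, (min x t - c) * deriv (deriv φ) t =
      (x - c) * (deriv φ d - deriv φ x) := by
    rw [← intervalIntegral.integral_deriv_eq_sub
      (fun t _ => hφ'.differentiable one_ne_zero t) (hcont.intervalIntegrable _ _),
      ← intervalIntegral.integral_const_mul]
    refine intervalIntegral.integral_congr fun t ht => ?_
    rw [uIcc_of_le hx.2] at ht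
    simp only [min_eq_left ht.1]
  have hmin (r s : ℝ) :
      IntervalIntegrable (fun t => (min x t - c) * deriv (deriv φ) t) volume r s :=
    Continuous.intervalIntegrable (by fun_prop) _ _
  have hlinear : IntervalIntegrable
      (fun t => (x - c) / (d - c) * ((t - c) * deriv (deriv φ) t)) volume c d :=
    Continuous.intervalIntegrable (by fun_prop) _ _
  calc ∫ t in c..d, greenKernel c d x t * deriv (deriv φ) t
      = ∫ t in c..d, ((x - c) / (d - c) * ((t - c) * deriv (deriv φ) t) -
          (min x t - c) * deriv (deriv φ) t) :=
        intervalIntegral.integral_congr fun t _ => by simp only [greenKernel]; ring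
    _ = (x - c) / (d - c) * ((d - c) * deriv φ d - φ d + φ c) -
          ((x - c) * deriv φ x - φ x + (x - c) * (deriv φ d - deriv φ x)) := by
        rw [intervalIntegral.integral_sub hlinear (hmin c d), intervalIntegral.integral_const_mul,
          integral_sub_mul_deriv_deriv hφ,
          ← intervalIntegral.integral_add_adjacent_intervals (hmin c x) (hmin x d), hleft, hright]
    _ = φ x := by
        rw [hc, hd]
        field_simp
        ring

/-- The Green operator on functions: `greenTransform c d g` solves `f_xx = g` on `(c, d)` with
`f(c) = f(d) = 0`. -/
def greenTransform (c d : ℝ) : (ℝ → ℂ) → ℝ → ℂ := kernelTransform (greenKernel c d) c d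

section Green

variable {c d : ℝ} {f g : ℝ → ℂ}

theorem continuousOn_greenTransform (hg : IntegrableOn g (Ioo c d)) :
    ContinuousOn (greenTransform c d g) (Icc c d) :=
  continuousOn_kernelTransform (continuous_greenKernel c d) hg

theorem memLp_greenTransform (hg : IntegrableOn g (Ioo c d)) :
    MemLp (greenTransform c d g) 2 (volume.restrict (Ioo c d)) :=
  memLp_of_continuousOn (continuousOn_greenTransform hg)

theorem hasValue_greenTransform (hg : IntegrableOn g (Ioo c d)) (x : ℝ) :
    HasValue c d (greenTransform c d g) x (greenTransform c d g x) :=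
  hasValue_of_continuousOn (continuousOn_greenTransform hg)

theorem greenTransform_left : greenTransform c d g c = 0 :=
  setIntegral_eq_zero_of_forall_eq_zero fun t ht => by
    rw [greenKernel_left (Ioo_subset_Icc_self ht), zero_smul]

theorem greenTransform_right : greenTransform c d g d = 0 :=
  setIntegral_eq_zero_of_forall_eq_zero fun t ht => by
    rw [greenKernel_right (ht.1.trans ht.2) (Ioo_subset_Icc_self ht), zero_smul]

theorem IsTest.greenTransform_deriv_deriv {φ : ℝ → ℝ} (hφ : IsTest c d φ) {x : ℝ}
    (hx : x ∈ Ioo c d) : greenTransform c d (fun t => ((deriv (deriv φ) t : ℝ) : ℂ)) x = φ x := by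
  have hcd := hx.1.trans hx.2
  rw [← integral_greenKernel_mul_deriv_deriv hcd (Ioo_subset_Icc_self hx)
    (hφ.1.of_le ENat.LEInfty.out) (hφ.eq_zero (by simp)) (hφ.eq_zero (by simp)),
    ← intervalIntegral.integral_ofReal, ← setIntegral_Ioo hcd.le]
  simp only [greenTransform, kernelTransform, Complex.real_smul, Complex.ofReal_mul]

/-- Symmetry of the kernel moves the Green operator onto `φ_xx`, which it turns into `φ`. -/
theorem isWeakDeriv_greenTransform (hg : IntegrableOn g (Ioo c d)) :
    IsWeakDeriv c d 2 (greenTransform c d g) g := by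
  intro φ hφ
  have hφ'' : IntegrableOn (fun t => ((deriv (deriv φ) t : ℝ) : ℂ)) (Ioo c d) :=
    integrableOn_of_continuousOn
      (Complex.continuous_ofReal.comp hφ.test_deriv.test_deriv.1.continuous).continuousOn
  have hswap := integral_mul_kernelTransform (continuous_greenKernel c d) (greenKernel_comm c d)
    hφ'' hg
  simp only [iteratedDeriv_succ, iteratedDeriv_zero, Complex.real_smul]
  rw [even_two.neg_one_pow, one_mul]
  exact hswap.trans (setIntegral_congr_fun measurableSet_Ioo fun x hx =>
    congrArg (· * g x) (hφ.greenTransform_deriv_deriv hx))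

theorem memH_greenTransform (hcd : c < d) (hg : MemLp g 2 (volume.restrict (Ioo c d))) :
    MemH 2 c d (greenTransform c d g) :=
  (isWeakDeriv_greenTransform (memLp_integrableOn hg)).memH hcd
    (memLp_greenTransform (memLp_integrableOn hg)) hg

theorem IsWeakDeriv.ae_eq_greenTransform (hcd : c < d) (h : IsWeakDeriv c d 2 f g)
    (hf : IntegrableOn f (Ioo c d)) (hg : IntegrableOn g (Ioo c d))
    (hc : HasValue c d f c 0) (hd : HasValue c d f d 0) :
    f =ᵐ[volume.restrict (Ioo c d)] greenTransform c d g := by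
  have hGi := integrableOn_of_continuousOn (continuousOn_greenTransform hg)
  have hdiff := h.add ((isWeakDeriv_greenTransform hg).smul (-1)) hf
    (Integrable.smul (-1 : ℂ) hGi) hg (Integrable.smul (-1 : ℂ) hg)
  simp only [smul_eq_mul, neg_mul, one_mul, add_neg_cancel] at hdiff
  have hzero := ae_eq_zero_of_weakDeriv_two_zero hcd (hf.add hGi.neg) hdiff
    (by simpa [greenTransform_left, Pi.add_def] using
      hc.add ((hasValue_greenTransform hg c).smul (-1)))
    (by simpa [greenTransform_right, Pi.add_def] using
      hd.add ((hasValue_greenTransform hg d).smul (-1)))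
  filter_upwards [hzero] with x hx
  simpa [← sub_eq_add_neg, sub_eq_zero] using hx

/-- `greenTransform` as a linear map of `L²(c, d)`. -/
def greenLinearMap (c d : ℝ) : L2 c d →ₗ[ℂ] L2 c d where
  toFun f := (memLp_greenTransform f.integrableOn).toLp (greenTransform c d f)
  map_add' f g := by
    rw [← MemLp.toLp_add]
    refine MemLp.toLp_congr _ _ (Eventually.of_forall fun x => ?_)
    exact (congrFun (kernelTransform_congr (Lp.coeFn_add f g)) x).trans
      (kernelTransform_add (continuous_greenKernel c d) f.integrableOn g.integrableOn x)
  map_smul' r f := by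
    rw [RingHom.id_apply, ← MemLp.toLp_const_smul]
    refine MemLp.toLp_congr _ _ (Eventually.of_forall fun x => ?_)
    exact (congrFun (kernelTransform_congr (Lp.coeFn_smul r f)) x).trans (kernelTransform_smul r x)

theorem greenLinearMap_ae_eq (f : L2 c d) :
    greenLinearMap c d f =ᵐ[volume.restrict (Ioo c d)] greenTransform c d f :=
  MemLp.coeFn_toLp (memLp_greenTransform f.integrableOn)

theorem greenLinearMap_isSymmetric (c d : ℝ) : (greenLinearMap c d).IsSymmetric := by
  intro f g
  have hswap := integral_mul_kernelTransform (continuous_greenKernel c d) (greenKernel_comm c d)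
    (f := fun x => (starRingEnd ℂ) (f x)) (memLp_integrableOn (Lp.memLp f).star) g.integrableOn
  rw [L2.inner_def, L2.inner_def]
  simp only [RCLike.inner_apply']
  calc ∫ x in Ioo c d, (starRingEnd ℂ) (greenLinearMap c d f x) * g x
      = ∫ x in Ioo c d, (starRingEnd ℂ) (greenTransform c d f x) * g x :=
        integral_congr_ae ((greenLinearMap_ae_eq f).mono fun x hx => by simp only [hx])
    _ = ∫ x in Ioo c d, (starRingEnd ℂ) (f x) * greenTransform c d g x := by
        simp only [greenTransform, ← kernelTransform_conj]
        exact hswap.symm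
    _ = ∫ x in Ioo c d, (starRingEnd ℂ) (f x) * greenLinearMap c d g x :=
        integral_congr_ae ((greenLinearMap_ae_eq g).mono fun x hx => by simp only [hx])

/-- The bounded inverse of the Dirichlet second derivative on `L²(c, d)`; boundedness comes from
symmetry through the Hellinger–Toeplitz theorem. -/
def greenOperator (c d : ℝ) : L2 c d →L[ℂ] L2 c d :=
  ⟨greenLinearMap c d, (greenLinearMap_isSymmetric c d).continuous⟩

theorem greenOperator_ae_eq (f : L2 c d) :
    greenOperator c d f =ᵐ[volume.restrict (Ioo c d)] greenTransform c d f :=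
  greenLinearMap_ae_eq f

theorem inner_greenOperator_left (f g : L2 c d) :
    inner ℂ (greenOperator c d f) g = inner ℂ f (greenOperator c d g) :=
  greenLinearMap_isSymmetric c d f g

theorem isSelfAdjoint_greenOperator (c d : ℝ) : IsSelfAdjoint (greenOperator c d) :=
  ContinuousLinearMap.isSelfAdjoint_iff_isSymmetric.2 (greenLinearMap_isSymmetric c d)

theorem isWeakDeriv_greenOperator (f : L2 c d) : IsWeakDeriv c d 2 (greenOperator c d f) f :=
  (isWeakDeriv_greenTransform f.integrableOn).congr_left (greenOperator_ae_eq f).symm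

theorem memH_greenOperator (hcd : c < d) (f : L2 c d) : MemH 2 c d (greenOperator c d f) :=
  (memH_greenTransform hcd (Lp.memLp f)).congr (greenOperator_ae_eq f).symm

theorem weakDeriv_two_greenOperator (f : L2 c d) : weakDeriv c d 2 (greenOperator c d f) = f :=
  (isWeakDeriv_greenOperator f).weakDeriv_eq

theorem greenOperator_injective (c d : ℝ) : Function.Injective (greenOperator c d) :=
  Function.LeftInverse.injective (g := fun f : L2 c d => weakDeriv c d 2 f) fun f =>
    weakDeriv_two_greenOperator f

theorem value_greenOperator (hcd : c < d) {x : ℝ} (hx : x ∈ Icc c d) (f : L2 c d) :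
    value c d (greenOperator c d f) x = greenTransform c d f x :=
  ((hasValue_greenTransform f.integrableOn x).congr (greenOperator_ae_eq f).symm).value_eq hcd hx

theorem MemH.eq_greenOperator (hcd : c < d) {f : L2 c d} (hf : MemH 2 c d f)
    (hc : value c d f c = 0) (hd : value c d f d = 0) :
    f = greenOperator c d (weakDeriv c d 2 f) := by
  refine Lp.ext (((hf.isWeakDeriv le_rfl).ae_eq_greenTransform hcd f.integrableOn
    (L2.integrableOn _) ?_ ?_).trans (greenOperator_ae_eq _).symm)
  · exact hc ▸ hf.hasValue hcd one_le_two (left_mem_Icc.2 hcd.le)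
  · exact hd ▸ hf.hasValue hcd one_le_two (right_mem_Icc.2 hcd.le)

/-- The Green function with pole `x`, as the vector of `L²(c, d)` representing `g ↦ f(x)`, where
`f` solves `f_xx = g` with `f(c) = f(d) = 0`. -/
def greenVec (c d x : ℝ) : L2 c d :=
  MemLp.toLp (fun t => (greenKernel c d x t : ℂ)) (memLp_of_continuousOn
    (Complex.continuous_ofReal.comp ((continuous_greenKernel c d).uncurry_left x)).continuousOn)

theorem greenVec_ae_eq (c d x : ℝ) :
    greenVec c d x =ᵐ[volume.restrict (Ioo c d)] fun t => (greenKernel c d x t : ℂ) :=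
  MemLp.coeFn_toLp _

theorem inner_greenVec (x : ℝ) (f : L2 c d) :
    inner ℂ (greenVec c d x) f = greenTransform c d f x := by
  rw [L2.inner_def]
  refine integral_congr_ae ((greenVec_ae_eq c d x).mono fun t ht => ?_)
  simp only [ht, RCLike.inner_apply', Complex.conj_ofReal, Complex.real_smul]

theorem hasValue_greenVec (c d x y : ℝ) :
    HasValue c d (greenVec c d x) y (greenKernel c d x y) :=
  ⟨_, (Complex.continuous_ofReal.comp ((continuous_greenKernel c d).uncurry_left x)).continuousOn,
    greenVec_ae_eq c d x, rfl⟩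

end Green

section Hilbert

variable {H : Type*} [NormedAddCommGroup H] [InnerProductSpace ℂ H] [CompleteSpace H]

theorem surjective_smul_one_add_smul {T : H →L[ℂ] H} (hT : 0 ≤ T) {a r : ℝ} (ha : 0 < a)
    (hr : 0 ≤ r) : Function.Surjective (a • (1 : H →L[ℂ] H) + r • T) := by
  have hpos := ((isStrictlyPositive_one (A := H →L[ℂ] H)).smul ha).add_nonneg (smul_nonneg hr hT)
  exact (ContinuousLinearMap.isUnit_iff_bijective.1 hpos.isUnit).2

theorem smul_rankOne_add_smul_mul_self_nonneg (k : H) {T : H →L[ℂ] H} (hT : IsSelfAdjoint T)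
    {a r : ℝ} (ha : 0 ≤ a) (hr : 0 ≤ r) :
    0 ≤ a • InnerProductSpace.rankOne ℂ k k + r • (T * T) :=
  add_nonneg
    (smul_nonneg ha ((ContinuousLinearMap.nonneg_iff_isPositive _).2
      (InnerProductSpace.isPositive_rankOne_self k)))
    (smul_nonneg hr hT.mul_self_nonneg)

end Hilbert

/-- The distribution defined by `f ∈ L²(c, d)` evaluated at a test function, as a linear
functional of `f`. -/
def IsTest.pairing {c d : ℝ} {φ : ℝ → ℝ} (hφ : IsTest c d φ) : L2 c d →ₗ[ℂ] ℂ where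
  toFun f := ∫ x in Ioo c d, φ x • f x
  map_add' f g := by
    rw [← integral_add (hφ.integrable_smul f.integrableOn) (hφ.integrable_smul g.integrableOn)]
    refine integral_congr_ae ((Lp.coeFn_add f g).mono fun x hx => ?_)
    simp only [hx, Pi.add_apply, smul_add]
  map_smul' r f := by
    rw [RingHom.id_apply, ← integral_smul]
    refine integral_congr_ae ((Lp.coeFn_smul r f).mono fun x hx => ?_)
    simp only [hx, Pi.smul_apply, smul_comm r]

theorem IsTest.pairing_iteratedDeriv_two_greenVec {c d x : ℝ} {φ : ℝ → ℝ} (hφ : IsTest c d φ)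
    (hx : x ∈ Ioo c d) : (hφ.test_iteratedDeriv 2).pairing (greenVec c d x) = φ x := by
  rw [← hφ.greenTransform_deriv_deriv hx]
  refine integral_congr_ae ((greenVec_ae_eq c d x).mono fun t ht => ?_)
  simp only [ht, iteratedDeriv_succ, iteratedDeriv_zero, Complex.real_smul, mul_comm]

section Restriction

variable {c d c' d' : ℝ} {u m : ℝ → ℂ} {A B : ℂ}

theorem MemH.weakDeriv_mono {j k : ℕ} (h : MemH j c d u) (hk : k ≤ j) (hc : c ≤ c')
    (hd : d' ≤ d) :
    weakDeriv c' d' k u =ᵐ[volume.restrict (Ioo c' d')] weakDeriv c d k u :=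
  ((h.isWeakDeriv hk).mono hc hd).weakDeriv_ae_eq
    ((Lp.memLp _).mono_measure (Measure.restrict_mono (Ioo_subset_Ioo hc hd) le_rfl))

theorem memLp_affine (c d : ℝ) (A B : ℂ) :
    MemLp (fun x : ℝ => A + x * B) 2 (volume.restrict (Ioo c d)) :=
  memLp_of_continuousOn (Continuous.continuousOn (by fun_prop))

theorem IsWeakDeriv.add_affine (hcd : c ≤ d) {f g : ℝ → ℂ} (h : IsWeakDeriv c d 1 f g)
    (hf : IntegrableOn f (Ioo c d)) (hg : IntegrableOn g (Ioo c d)) (A B : ℂ) :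
    IsWeakDeriv c d 1 (fun x : ℝ => f x + (A + x * B)) fun x => g x + B :=
  h.add (isWeakDeriv_affine hcd A B) hf (memLp_integrableOn (memLp_affine c d A B)) hg (by simp)

theorem MemH.isWeakDeriv_one_add_affine (hm : MemH 2 c d m) (hc : c ≤ c') (hd : d' ≤ d)
    (hcd : c' < d') (A B : ℂ) :
    IsWeakDeriv c' d' 1 (fun x : ℝ => m x + (A + x * B)) fun x => weakDeriv c d 1 m x + B :=
  ((hm.isWeakDeriv one_le_two).mono hc hd).add_affine hcd.le
    ((memLp_integrableOn hm.1).mono_set (Ioo_subset_Ioo hc hd))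
    ((L2.integrableOn _).mono_set (Ioo_subset_Ioo hc hd)) A B

theorem MemH.memH_four_of_isWeakDeriv_two (hm : MemH 2 c d m) (hc : c ≤ c') (hd : d' ≤ d)
    (hcd : c' < d') (hu : MemLp u 2 (volume.restrict (Ioo c' d')))
    (h : IsWeakDeriv c' d' 2 u fun x => m x + (A + x * B)) : MemH 4 c' d' u := by
  have hsub := Ioo_subset_Ioo hc hd
  have hthird : IsWeakDeriv c' d' 1 (fun x => weakDeriv c d 1 m x + B) (weakDeriv c d 2 m) := by
    simpa using (((hm.isWeakDeriv one_le_two).step (hm.isWeakDeriv le_rfl)).mono hc hd).add_affine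
      hcd.le ((L2.integrableOn _).mono_set hsub) ((L2.integrableOn _).mono_set hsub) B 0
  exact ((h.trans (hm.isWeakDeriv_one_add_affine hc hd hcd A B)).trans hthird).memH hcd hu
    ((Lp.memLp _).mono_measure (Measure.restrict_mono hsub le_rfl))

theorem MemH.value_weakDeriv_two (hm : MemH 2 c d m) (hc : c ≤ c') (hd : d' ≤ d)
    (hcd : c' < d') (h : IsWeakDeriv c' d' 2 u fun x => m x + (A + x * B)) {x : ℝ}
    (hx : x ∈ Icc c' d') :
    value c' d' (weakDeriv c' d' 2 u) x = value c d m x + (A + x * B) := by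
  have hmem := (hm.1.mono_measure (Measure.restrict_mono (Ioo_subset_Ioo hc hd) le_rfl)).add
    (memLp_affine c' d' A B)
  have hvalue := hm.hasValue ((hc.trans_lt hcd).trans_le hd) one_le_two (Icc_subset_Icc hc hd hx)
  have haffine := hasValue_of_continuousOn (x := x)
    (Continuous.continuousOn (s := Icc c' d') (f := fun y : ℝ => A + y * B) (by fun_prop))
  exact (((hvalue.mono hc hd).add haffine).congr (h.weakDeriv_ae_eq hmem).symm).value_eq hcd hx

theorem MemH.value_weakDeriv_three (hm : MemH 2 c d m) (hc : c ≤ c') (hd : d' ≤ d)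
    (hcd : c' < d') (h : IsWeakDeriv c' d' 2 u fun x => m x + (A + x * B)) {x : ℝ}
    (hx : x ∈ Icc c' d') :
    value c' d' (weakDeriv c' d' 3 u) x = value c d (weakDeriv c d 1 m) x + B := by
  have hmem := ((Lp.memLp (weakDeriv c d 1 m)).mono_measure
    (Measure.restrict_mono (Ioo_subset_Ioo hc hd) le_rfl)).add (memLp_const B)
  have hderiv := (h.trans (hm.isWeakDeriv_one_add_affine hc hd hcd A B)).weakDeriv_ae_eq hmem
  have hvalue := hm.hasValue_weakDeriv (k := 1) ((hc.trans_lt hcd).trans_le hd) le_rfl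
    (Icc_subset_Icc hc hd hx)
  exact (((hvalue.mono hc hd).add (hasValue_of_continuousOn continuousOn_const)).congr
    hderiv.symm).value_eq hcd hx

end Restriction

namespace Params

variable {p : Params}

theorem ξ_mem_Icc (p : Params) : p.ξ ∈ Icc (0 : ℝ) 1 := Ioo_subset_Icc_self p.ξ_mem

theorem Disp.toL2_eq_greenOperator (u : p.Disp) : u.toL2 = greenOperator 0 1 u.dxx :=
  u.memH.eq_greenOperator zero_lt_one u.value_zero u.value_one

theorem Disp.inner_greenVec_dxx (u : p.Disp) {x : ℝ} (hx : x ∈ Icc (0 : ℝ) 1) :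
    inner ℂ (greenVec 0 1 x) u.dxx = value 0 1 u.toL2 x := by
  rw [inner_greenVec, ← value_greenOperator zero_lt_one hx, ← u.toL2_eq_greenOperator]

/-- The displacement with second derivative `w`. -/
def Disp.ofDxx (p : Params) (w : L2 0 1) : p.Disp :=
  ⟨greenOperator 0 1 w, memH_greenOperator zero_lt_one w,
    by rw [value_greenOperator zero_lt_one (by simp), greenTransform_left],
    by rw [value_greenOperator zero_lt_one (by simp), greenTransform_right]⟩

theorem Disp.dxx_ofDxx (w : L2 0 1) : (Disp.ofDxx p w).dxx = w := weakDeriv_two_greenOperator w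

/-- The bending moment `a w` of a beam with curvature `w = u_xx`, corrected by `α s` times the
Green function with pole `ξ`: for `s = v(ξ)` the correction cancels the Dirac mass at `ξ` of the
second derivative of `a u_xx`. -/
def moment (p : Params) (w : L2 0 1) (s : ℂ) : L2 0 1 :=
  (p.a : ℂ) • w + ((p.α : ℂ) * s) • greenVec 0 1 p.ξ

theorem moment_ae_eq (w : L2 0 1) (s : ℂ) : p.moment w s =ᵐ[volume.restrict (Ioo 0 1)]
    fun x => (p.a : ℂ) • w x + ((p.α : ℂ) * s) • greenVec 0 1 p.ξ x :=
  (Lp.coeFn_add _ _).trans ((Lp.coeFn_smul _ _).add (Lp.coeFn_smul _ _))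

theorem hasValue_moment {c d x : ℝ} {w : L2 0 1} {s z : ℂ} (hc : 0 ≤ c) (hd : d ≤ 1)
    (hw : HasValue c d w x z) : HasValue c d (p.moment w s) x
      ((p.a : ℂ) • z + ((p.α : ℂ) * s) • (greenKernel 0 1 p.ξ x : ℂ)) :=
  ((hw.smul _).add (((hasValue_greenVec 0 1 p.ξ x).mono hc hd).smul _)).congr
    (ae_restrict_of_ae_restrict_of_subset (Ioo_subset_Ioo hc hd) (moment_ae_eq w s).symm)

theorem IsAccel.isWeakDeriv_moment {u v : L2 0 1} {g : L2 0 1} (hu : MemH 2 0 1 u)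
    (h : p.IsAccel u v g) :
    IsWeakDeriv 0 1 2 (p.moment (weakDeriv 0 1 2 u) (value 0 1 v p.ξ))
      (-(g + (p.b : ℂ) • v) : L2 0 1) := by
  intro φ hφ
  have huxx := hu.isWeakDeriv le_rfl _ (hφ.test_iteratedDeriv 2)
  have hiter : iteratedDeriv 2 (iteratedDeriv 2 φ) = iteratedDeriv 4 φ := by
    simp only [iteratedDeriv_eq_iterate, ← Function.iterate_add_apply]
  rw [hiter, even_two.neg_one_pow, one_mul] at huxx
  have haccel := h φ hφ
  rw [huxx] at haccel
  change (hφ.test_iteratedDeriv 2).pairing _ = (-1) ^ 2 * hφ.pairing _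
  change hφ.pairing g = -(p.a : ℂ) * (hφ.test_iteratedDeriv 2).pairing (weakDeriv 0 1 2 u)
    - (p.b : ℂ) * hφ.pairing v - (p.α : ℂ) * (φ p.ξ • value 0 1 v p.ξ) at haccel
  simp only [moment, map_add, map_neg, map_smul, haccel, smul_eq_mul, Complex.real_smul,
    hφ.pairing_iteratedDeriv_two_greenVec p.ξ_mem]
  ring

theorem value_moment_eq_zero {u : ℝ → ℂ} {c d x : ℝ} {s : ℂ} (hc : 0 ≤ c) (hd : d ≤ 1)
    (hcd : c < d) (hx : x ∈ Icc c d) (hu : MemH 2 0 1 u)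
    (huxx : HasValue c d (weakDeriv c d 2 u) x 0) (hk : greenKernel 0 1 p.ξ x = 0)
    (hm : MemH 2 0 1 (p.moment (weakDeriv 0 1 2 u) s)) :
    value 0 1 (p.moment (weakDeriv 0 1 2 u) s) x = 0 := by
  have hvalue := hasValue_moment (p := p) (s := s) hc hd
    (huxx.congr (hu.weakDeriv_mono le_rfl hc hd))
  rw [hk, Complex.ofReal_zero, smul_zero, smul_zero, add_zero] at hvalue
  rw [← hm.value_mono one_le_two hc hd hcd hx, hvalue.value_eq hcd hx]

theorem InDomain.value_moment_zero {u v : ℝ → ℂ} (h : p.InDomain u v) (hu : MemH 2 0 1 u) {s : ℂ}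
    (hm : MemH 2 0 1 (p.moment (weakDeriv 0 1 2 u) s)) :
    value 0 1 (p.moment (weakDeriv 0 1 2 u) s) 0 = 0 := by
  have hξ := p.ξ_mem
  have hmem : (0 : ℝ) ∈ Icc 0 p.ξ := left_mem_Icc.2 hξ.1.le
  have huxx := h.left.hasValue_weakDeriv (k := 2) hξ.1 (by norm_num) hmem
  rw [h.uxx_zero] at huxx
  have hk : greenKernel 0 1 p.ξ 0 = 0 := by rw [greenKernel_comm, greenKernel_left p.ξ_mem_Icc]
  exact value_moment_eq_zero le_rfl hξ.2.le hξ.1 hmem hu huxx hk hm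

theorem InDomain.value_moment_one {u v : ℝ → ℂ} (h : p.InDomain u v) (hu : MemH 2 0 1 u) {s : ℂ}
    (hm : MemH 2 0 1 (p.moment (weakDeriv 0 1 2 u) s)) :
    value 0 1 (p.moment (weakDeriv 0 1 2 u) s) 1 = 0 := by
  have hξ := p.ξ_mem
  have hmem : (1 : ℝ) ∈ Icc p.ξ 1 := right_mem_Icc.2 hξ.2.le
  have huxx := h.right.hasValue_weakDeriv (k := 2) hξ.2 (by norm_num) hmem
  rw [h.uxx_one] at huxx
  have hk : greenKernel 0 1 p.ξ 1 = 0 := by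
    rw [greenKernel_comm, greenKernel_right zero_lt_one p.ξ_mem_Icc]
  exact value_moment_eq_zero hξ.1.le le_rfl hξ.2 hmem hu huxx hk hm

theorem moment_eq_greenOperator (U : p.domain) :
    p.moment (weakDeriv 0 1 2 U.1.u) (value 0 1 U.1.v p.ξ) =
      greenOperator 0 1 (-(accel U + (p.b : ℂ) • U.1.v)) := by
  have hderiv := (isAccel_accel U).isWeakDeriv_moment U.1.memH_u
  have hm := hderiv.memH zero_lt_one (Lp.memLp _) (Lp.memLp _)
  have h := hm.eq_greenOperator zero_lt_one (U.2.value_moment_zero U.1.memH_u hm)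
    (U.2.value_moment_one U.1.memH_u hm)
  rwa [hderiv.weakDeriv_eq] at h

theorem accel_eq_of_moment_eq {U : p.domain} {q : L2 0 1}
    (h : p.moment (weakDeriv 0 1 2 U.1.u) (value 0 1 U.1.v p.ξ) = greenOperator 0 1 q) :
    accel U = -(q + (p.b : ℂ) • U.1.v) := by
  rw [greenOperator_injective 0 1 (h.symm.trans (moment_eq_greenOperator U))]
  module

theorem re_inner_operator (U : p.operator.domain) :
    (inner ℂ (U : p.Energy) (p.operator U)).re =
      -p.b * ‖(U : p.Energy).v‖ ^ 2 - p.α * ‖value 0 1 (U : p.Energy).v p.ξ‖ ^ 2 := by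
  let U' : p.domain := U
  set g : L2 0 1 := accel U'
  set v : L2 0 1 := U'.1.v
  set w : L2 0 1 := weakDeriv 0 1 2 U'.1.u
  set s : ℂ := value 0 1 v p.ξ
  set z : L2 0 1 := (velocity U').dxx
  have hv : v = greenOperator 0 1 z := (velocity U').toL2_eq_greenOperator
  have hs : inner ℂ (greenVec 0 1 p.ξ) z = s := (velocity U').inner_greenVec_dxx p.ξ_mem_Icc
  have haw : (p.a : ℂ) • w =
      greenOperator 0 1 (-(g + (p.b : ℂ) • v)) - ((p.α : ℂ) * s) • greenVec 0 1 p.ξ :=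
    eq_sub_of_add_eq (moment_eq_greenOperator U')
  have hinner : inner ℂ (U : p.Energy) (p.operator U) =
      inner ℂ v g - inner ℂ g v - (p.b : ℂ) * ‖v‖ ^ 2 - (p.α : ℂ) * ‖s‖ ^ 2 :=
    calc inner ℂ (U : p.Energy) (p.operator U)
        = (p.a : ℂ) * inner ℂ w z + inner ℂ v g := rfl
      _ = inner ℂ ((p.a : ℂ) • w) z + inner ℂ v g := by
          rw [inner_smul_left, Complex.conj_ofReal]
      _ = inner ℂ (-(g + (p.b : ℂ) • v)) v - (p.α : ℂ) * ((starRingEnd ℂ) s * s)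
            + inner ℂ v g := by
          rw [haw, inner_sub_left, inner_greenOperator_left, ← hv, inner_smul_left, hs, map_mul,
            Complex.conj_ofReal, mul_assoc]
      _ = inner ℂ v g - inner ℂ g v - (p.b : ℂ) * ‖v‖ ^ 2 - (p.α : ℂ) * ‖s‖ ^ 2 := by
          rw [inner_neg_left, inner_add_left, inner_smul_left, Complex.conj_ofReal,
            inner_self_eq_norm_sq_to_K, RCLike.conj_mul]
          simp only [Complex.coe_algebraMap]
          ring
  have hre : (inner ℂ g v).re = (inner ℂ v g).re := by rw [← inner_conj_symm, Complex.conj_re]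
  rw [hinner]
  simp only [Complex.sub_re, hre, ← Complex.ofReal_pow, ← Complex.ofReal_mul, Complex.ofReal_re]
  change _ = -p.b * ‖v‖ ^ 2 - p.α * ‖s‖ ^ 2
  ring

theorem ae_eq_of_moment_eq {w q : L2 0 1} {s : ℂ} (h : p.moment w s = greenOperator 0 1 q) :
    w =ᵐ[volume.restrict (Ioo 0 1)] fun x => greenOperator 0 1 ((p.a : ℂ)⁻¹ • q) x -
      ((p.α / p.a : ℝ) : ℂ) * s * greenKernel 0 1 p.ξ x := by
  have ha : (p.a : ℂ) ≠ 0 := Complex.ofReal_ne_zero.2 p.a_pos.ne'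
  have hw : w = greenOperator 0 1 ((p.a : ℂ)⁻¹ • q) -
      (((p.α / p.a : ℝ) : ℂ) * s) • greenVec 0 1 p.ξ := by
    rw [map_smul, ← h, moment, smul_add, smul_smul, smul_smul, inv_mul_cancel₀ ha]
    push_cast
    module
  conv_lhs => rw [hw]
  filter_upwards [Lp.coeFn_sub (greenOperator 0 1 ((p.a : ℂ)⁻¹ • q))
    ((((p.α / p.a : ℝ) : ℂ) * s) • greenVec 0 1 p.ξ),
    Lp.coeFn_smul (((p.α / p.a : ℝ) : ℂ) * s) (greenVec 0 1 p.ξ), greenVec_ae_eq 0 1 p.ξ]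
    with x hsub hsmul hk
  rw [hsub, Pi.sub_apply, hsmul, Pi.smul_apply, hk, smul_eq_mul]

theorem isWeakDeriv_left_of_moment_eq {w q : L2 0 1} {s : ℂ}
    (h : p.moment w s = greenOperator 0 1 q) :
    IsWeakDeriv 0 p.ξ 2 (greenOperator 0 1 w) fun x : ℝ =>
      greenOperator 0 1 ((p.a : ℂ)⁻¹ • q) x +
        (0 + x * (((p.α / p.a : ℝ) : ℂ) * s * (1 - p.ξ))) := by
  refine ((isWeakDeriv_greenOperator w).mono le_rfl p.ξ_mem.2.le).congr_right ?_
  filter_upwards [p.ae_restrict_left (ae_eq_of_moment_eq h), ae_restrict_mem measurableSet_Ioo]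
    with x hx hmem
  rw [hx, greenKernel, min_eq_right hmem.2.le]
  push_cast
  ring

theorem isWeakDeriv_right_of_moment_eq {w q : L2 0 1} {s : ℂ}
    (h : p.moment w s = greenOperator 0 1 q) :
    IsWeakDeriv p.ξ 1 2 (greenOperator 0 1 w) fun x : ℝ =>
      greenOperator 0 1 ((p.a : ℂ)⁻¹ • q) x +
        (((p.α / p.a : ℝ) : ℂ) * s * p.ξ + x * -(((p.α / p.a : ℝ) : ℂ) * s * p.ξ)) := by
  refine ((isWeakDeriv_greenOperator w).mono p.ξ_mem.1.le le_rfl).congr_right ?_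
  filter_upwards [p.ae_restrict_right (ae_eq_of_moment_eq h), ae_restrict_mem measurableSet_Ioo]
    with x hx hmem
  rw [hx, greenKernel, min_eq_left hmem.1.le]
  push_cast
  ring

theorem inDomain_of_moment_eq {w q : L2 0 1} {V : p.Disp}
    (h : p.moment w (value 0 1 V.toL2 p.ξ) = greenOperator 0 1 q) :
    p.InDomain (greenOperator 0 1 w) V.toL2 := by
  have hξ := p.ξ_mem
  have hm := memH_greenOperator zero_lt_one ((p.a : ℂ)⁻¹ • q)
  have hu := memH_greenOperator zero_lt_one w
  have hl := isWeakDeriv_left_of_moment_eq h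
  have hr := isWeakDeriv_right_of_moment_eq h
  have hξl := right_mem_Icc.2 hξ.1.le
  have hξr := left_mem_Icc.2 hξ.2.le
  refine ⟨hm.memH_four_of_isWeakDeriv_two le_rfl hξ.2.le hξ.1 ?_ hl,
    hm.memH_four_of_isWeakDeriv_two hξ.1.le le_rfl hξ.2 ?_ hr,
    V.memH, V.value_zero, V.value_one, ?_, ?_, ?_, ?_⟩
  · exact hu.1.mono_measure (Measure.restrict_mono (Ioo_subset_Ioo le_rfl hξ.2.le) le_rfl)
  · exact hu.1.mono_measure (Measure.restrict_mono (Ioo_subset_Ioo hξ.1.le le_rfl) le_rfl)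
  · rw [hm.value_weakDeriv_two le_rfl hξ.2.le hξ.1 hl (left_mem_Icc.2 hξ.1.le),
      value_greenOperator zero_lt_one (by simp), greenTransform_left]
    simp
  · rw [hm.value_weakDeriv_two hξ.1.le le_rfl hξ.2 hr (right_mem_Icc.2 hξ.2.le),
      value_greenOperator zero_lt_one (by simp), greenTransform_right]
    simp
  · rw [hm.value_weakDeriv_two le_rfl hξ.2.le hξ.1 hl hξl,
      hm.value_weakDeriv_two hξ.1.le le_rfl hξ.2 hr hξr]
    ring
  · rw [hm.value_weakDeriv_three le_rfl hξ.2.le hξ.1 hl hξl,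
      hm.value_weakDeriv_three hξ.1.le le_rfl hξ.2 hr hξr]
    ring

/-- The nonnegative operator `α ⟨k_ξ, ·⟩ k_ξ + r G²`, with `k_ξ` the Green function with pole `ξ`
and `G` the Green operator: it sends the second derivative of a velocity `V` to the part
`α V(ξ) k_ξ + r G V` of the resolvent equation that depends on `V`. -/
def dampingOperator (p : Params) (r : ℝ) : L2 0 1 →L[ℂ] L2 0 1 :=
  p.α • InnerProductSpace.rankOne ℂ (greenVec 0 1 p.ξ) (greenVec 0 1 p.ξ) +
    r • (greenOperator 0 1 * greenOperator 0 1)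

theorem dampingOperator_nonneg (p : Params) {r : ℝ} (hr : 0 ≤ r) : 0 ≤ p.dampingOperator r :=
  smul_rankOne_add_smul_mul_self_nonneg _ (isSelfAdjoint_greenOperator 0 1) p.α_pos.le hr

theorem dampingOperator_dxx (r : ℝ) (V : p.Disp) :
    p.dampingOperator r V.dxx = ((p.α : ℂ) * value 0 1 V.toL2 p.ξ) • greenVec 0 1 p.ξ +
      (r : ℂ) • greenOperator 0 1 V.toL2 := by
  change p.α • (inner ℂ (greenVec 0 1 p.ξ) V.dxx • greenVec 0 1 p.ξ) +
    r • greenOperator 0 1 (greenOperator 0 1 V.dxx) = _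
  rw [V.inner_greenVec_dxx p.ξ_mem_Icc, ← V.toL2_eq_greenOperator, mul_smul, Complex.coe_smul,
    Complex.coe_smul]
  rfl

theorem exists_moment_eq {l : ℝ} (hl : 0 ≤ l) (f : p.Disp) (g : L2 0 1) :
    ∃ w : L2 0 1, ∀ V : p.Disp, V = (l : ℂ) • Disp.ofDxx p w - f →
      p.moment w (value 0 1 V.toL2 p.ξ) =
        greenOperator 0 1 (g - ((l + p.b : ℝ) : ℂ) • V.toL2) := by
  set S := p.dampingOperator (l + p.b)
  have hS : 0 ≤ S := p.dampingOperator_nonneg (add_nonneg hl p.b_pos.le)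
  obtain ⟨w, hw⟩ := surjective_smul_one_add_smul hS p.a_pos hl (greenOperator 0 1 g + S f.dxx)
  refine ⟨w, fun V hV => ?_⟩
  have hdxx : V.dxx = (l : ℂ) • w - f.dxx := by rw [hV, map_sub, map_smul, Disp.dxx_ofDxx]
  have hSV : S V.dxx = _ := dampingOperator_dxx (l + p.b) V
  have hw' : (p.a : ℂ) • w + (l : ℂ) • S w = greenOperator 0 1 g + S f.dxx := hw
  rw [hdxx, map_sub, map_smul] at hSV
  rw [moment, map_sub, map_smul]
  linear_combination (norm := module) hw' - hSV

theorem exists_resolvent {l : ℝ} (hl : 0 ≤ l) (F : p.Energy) :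
    ∃ U : p.operator.domain, (l : ℂ) • (U : p.Energy) - p.operator U = F := by
  set f : p.Disp := F.fst
  set g : L2 0 1 := F.v
  obtain ⟨w, hw⟩ := exists_moment_eq hl f g
  set V : p.Disp := (l : ℂ) • Disp.ofDxx p w - f with hV
  have hmoment := hw V rfl
  let U : p.domain := ⟨WithLp.toLp 2 (Disp.ofDxx p w, V.toL2), inDomain_of_moment_eq hmoment⟩
  have huxx : weakDeriv 0 1 2 U.1.u = w := Disp.dxx_ofDxx w
  have haccel : accel U = (l : ℂ) • V.toL2 - g := by
    have hvel : U.1.v = V.toL2 := rfl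
    rw [accel_eq_of_moment_eq (by rw [huxx]; exact hmoment), hvel]
    push_cast
    module
  refine ⟨U, ?_⟩
  have hF : F = WithLp.toLp 2 (f, g) := rfl
  have hU : (U : p.Energy) = WithLp.toLp 2 (Disp.ofDxx p w, V.toL2) := rfl
  have hA : p.operator U = WithLp.toLp 2 (V, accel U) := rfl
  rw [hA, haccel, hF, hU, ← WithLp.toLp_smul, ← WithLp.toLp_sub, Prod.smul_mk, Prod.mk_sub_mk, hV,
    sub_sub_cancel, sub_sub_cancel]

end Params

end Beam

end

theorem mainTheorem8 (p : Beam.Params) :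
    p.operator.IsMDissipative ∧
    (∀ U : p.operator.domain,
      (inner ℂ (U : p.Energy) (p.operator U)).re =
        -p.b * ‖(U : p.Energy).v‖ ^ 2 - p.α * ‖Beam.value 0 1 (U : p.Energy).v p.ξ‖ ^ 2) ∧
    Function.Surjective (fun U : p.operator.domain => -p.operator U) := by
  refine ⟨⟨fun U => ?_, fun μ hμ F => Beam.Params.exists_resolvent hμ.le F⟩,
    Beam.Params.re_inner_operator, fun F => ?_⟩
  · rw [Beam.Params.re_inner_operator U]
    have hvisc := mul_nonneg p.b_pos.le (sq_nonneg ‖(U : p.Energy).v‖)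
    have hpoint := mul_nonneg p.α_pos.le (sq_nonneg ‖Beam.value 0 1 (U : p.Energy).v p.ξ‖)
    linarith
  · obtain ⟨U, hU⟩ := Beam.Params.exists_resolvent le_rfl F
    exact ⟨U, by simpa using hU⟩
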